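/- Let $\mathcal G_1$ be the figure-8 graph (one vertex, two loops $e_1,e_2$). Replace each edge by its two oriented copies and let $A(e,e')=1$ if the oriented edge $e'$ begins where $e$ ends and $e'\neq\bar e$, and $A(e,e')=0$ otherwise; let $(\Sigma_A^+,\sigma)$ be the associated one-sided subshift of finite type. A weighting $l=(l_1,l_2)\in\mathbb R_{>0}^2$ of the edges has entropy $h(l)=\lim_{T\to\infty}\frac1T\log\#\{\gamma:\ l(\gamma)<T\}$, where $\gamma=(e_0,\dots,e_n=e_0)$, $n\ge1$, runs over the closed cycles of oriented edges without backtracking and $l(\gamma)=\sum_{i<n}l(e_i)$. Put $\mathcal M^1=\{l\in\mathbb R_{>0}^2:\ h(l)=1\}$, and regard functions on the edges as functions on $\Sigma_A^+$ through the zeroth coordinate. For $l\in\mathcal M^1$ let $m_{-l}$ be the equilibrium state of $-l$: $m_{-l}=v\mu/\int v\,d\mu$, where $v>0$ is continuous with $\mathcal L_{-l}v=v$, $\mu$ is a probability measure with $\mathcal L_{-l}^*\mu=\mu$, and $(\mathcal L_fw)(x)=\sum_{\sigma y=x}e^{f(y)}w(y)$. Let $T_l\mathcal M^1=\{\phi:\{e_1,e_2\}\to\mathbb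 R:\ \int\phi\,dm_{-l}=0\}$ and, for $\phi\in T_l\mathcal M^1$, $$\|\phi\|_{WP}^2=\frac{\operatorname{Var}(\phi,m_{-l})}{\int l\,dm_{-l}},\qquad \operatorname{Var}(\phi,m)=\lim_{n\to\infty}\frac1n\int\Big(\sum_{i<n}\phi\circ\sigma^i-n\int\phi\,dm\Big)^2dm .$$ Let $d_{WP}(l,l')$ be the infimum of $\int_0^1\|\dot\gamma(t)\|_{WP}\,dt$ over the continuously differentiable curves $\gamma:[0,1]\to\mathcal M^1$ from $l$ to $l'$. Then: 1. $\mathcal M^1=\{c(x):x>0\}$ with $c(x)=\big(x,\,-\log\frac{1-e^{-x}}{1+3e^{-x}}\big)$. For every $l\in\mathcal M^1$ the equilibrium state $m_{-l}$ exists and is unique, $\int l\,dm_{-l}>0$, and the limit defining $\operatorname{Var}(\phi,m_{-l})$ exists for all $\phi\in T_l\mathcal M^1$. For every $x>0$, $c$ is differentiable at $x$ and $T_{c(x)}\mathcal M^1=\mathbb R\,\dot c(x)$. 2. $d_{WP}$ is a metric on $\mathcal M^1$, and $(\mathcal M^1,d_{WP})$ is complete. 3. $\|\dot c(x)\|_{WP}^2\asymp\frac{-1}{x^2\log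 x}$ as $x\to0^+$ and $\|\dot c(x)\|_{WP}^2\asymp\frac1x$ as $x\to\infty$, where $f\asymp g$ means that $a<f/g<b$ near the limit for some constants $a,b>0$. 4. For every $x_0>0$, $d_{WP}(c(x_0),c(x))\to\infty$ as $x\to0^+$ and as $x\to\infty$. -/

import Mathlib

open Filter Topology MeasureTheory Set

noncomputable section

/-- A finite undirected multigraph (loops allowed) with vertices `V` and edges `Fin k`.
Each edge carries a reference orientation, from `src e` to `tgt e`. -/
structure FinGraph (V : Type) (k : ℕ) where
  src : Fin k → V
  tgt : Fin k → V

/-- Directed edges: `(e, true)` is `e` with its reference orientation, `(e, false)` is `e` with the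
opposite orientation. -/
abbrev DirEdge (k : ℕ) : Type := Fin k × Bool

/-- The same edge with the opposite orientation. -/
def DirEdge.bar {k : ℕ} (e : DirEdge k) : DirEdge k := (e.1, !e.2)

namespace FinGraph

variable {V : Type} {k : ℕ}

def origin (G : FinGraph V k) (e : DirEdge k) : V := if e.2 then G.src e.1 else G.tgt e.1

def terminus (G : FinGraph V k) (e : DirEdge k) : V := if e.2 then G.tgt e.1 else G.src e.1

/-- `A(e, e') = 1`: the directed edge `e'` follows `e` without backtracking. -/
def Adj (G : FinGraph V k) (e e' : DirEdge k) : Prop :=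
  G.origin e' = G.terminus e ∧ e' ≠ e.bar

/-- A closed cycle `(e_0, e_1, …, e_n = e_0)`, `n ≥ 1`, of directed edges without backtracking. -/
structure ClosedCycle (G : FinGraph V k) where
  n : ℕ
  pos : 0 < n
  edge : Fin (n + 1) → DirEdge k
  closed : edge (Fin.last n) = edge 0
  step : ∀ i : Fin n, G.Adj (edge i.castSucc) (edge i.succ)

/-- The length `l(e_0) + ⋯ + l(e_{n-1})` of a closed cycle. -/
def ClosedCycle.length {G : FinGraph V k} (γ : G.ClosedCycle) (l : Fin k → ℝ) : ℝ :=
  ∑ i : Fin γ.n, l (γ.edge i.castSucc).1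

/-- The limit `lim_{T → ∞} (1/T) log #{γ : l(γ) < T}` exists and equals `h`. -/
def HasEntropy (G : FinGraph V k) (l : Fin k → ℝ) (h : ℝ) : Prop :=
  Tendsto (fun T : ℝ => 1 / T * Real.log (({γ : G.ClosedCycle | γ.length l < T}.ncard : ℕ) : ℝ))
    atTop (𝓝 h)

/-- The moduli space of positive edge weightings with entropy one. -/
def entropyOne (G : FinGraph V k) : Set (Fin k → ℝ) :=
  {l | (∀ e, 0 < l e) ∧ G.HasEntropy l 1}

/-- The moduli space as a bare type (no topology or distance is inherited from `ℝ^k`). -/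
def EntropyOneSpace (G : FinGraph V k) : Type := {l : Fin k → ℝ // l ∈ G.entropyOne}

/-- The one-sided subshift of finite type of the graph. -/
abbrev Shift (G : FinGraph V k) : Type :=
  {x : ℕ → DirEdge k // ∀ n, G.Adj (x n) (x (n + 1))}

/-- The shift map. -/
def shift (G : FinGraph V k) (x : G.Shift) : G.Shift :=
  ⟨fun n => x.1 (n + 1), fun n => x.2 (n + 1)⟩

/-- An edge weighting as a locally constant function on the shift space. -/
def onShift (G : FinGraph V k) (φ : Fin k → ℝ) (x : G.Shift) : ℝ := φ (x.1 0).1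

/-- The transfer operator `(L_f w)(x) = ∑_{σ y = x} e^{f(y)} w(y)`; the sum is finite. -/
def transfer (G : FinGraph V k) (f w : G.Shift → ℝ) (x : G.Shift) : ℝ :=
  ∑ᶠ (y : G.Shift) (_ : G.shift y = x), Real.exp (f y) * w y

/-- `m` is the equilibrium state of the pressure-zero function `f`: the transfer operator has a
strictly positive continuous eigenfunction `v` for the eigenvalue `1` (which is therefore its maximal
eigenvalue, that is, the pressure of `f` is `log 1 = 0`), its dual fixes the probability measure `μ`,
and `m = v μ / ∫ v dμ`. -/
def IsEquilibriumState (G : FinGraph V k) (f : G.Shift → ℝ) (m : Measure G.Shift) : Prop :=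
  ∃ (v : C(G.Shift, ℝ)) (μ : Measure G.Shift),
    (∀ x, 0 < v x) ∧
    (∀ x, G.transfer f v x = v x) ∧
    IsProbabilityMeasure μ ∧
    (∀ φ : C(G.Shift, ℝ), ∫ x, G.transfer f φ x ∂μ = ∫ x, φ x ∂μ) ∧
    m = μ.withDensity (fun x => ENNReal.ofReal (v x / ∫ y, v y ∂μ))

/-- The equilibrium state `m_{-l}`. -/
def eqState (G : FinGraph V k) (l : Fin k → ℝ) : Measure G.Shift :=
  Classical.epsilon (G.IsEquilibriumState (fun x => -G.onShift l x))

/-- The `n`-th term `(1/n) ∫ (w^n - n ∫ w dm)² dm` of the sequence defining the variance. -/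
def varSeq (G : FinGraph V k) (w : G.Shift → ℝ) (m : Measure G.Shift) (n : ℕ) : ℝ :=
  1 / (n : ℝ) * ∫ x, (birkhoffSum G.shift w n x - n * ∫ y, w y ∂m) ^ 2 ∂m

/-- The (asymptotic) variance `Var(w, m)`. -/
def asympVar (G : FinGraph V k) (w : G.Shift → ℝ) (m : Measure G.Shift) : ℝ :=
  limUnder atTop (G.varSeq w m)

/-- The tangent space of the moduli space at `l`: the `φ` with `∫ φ dm_{-l} = 0`. -/
def tangentSpace (G : FinGraph V k) (l : Fin k → ℝ) : Set (Fin k → ℝ) :=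
  {φ | ∫ x, G.onShift φ x ∂(G.eqState l) = 0}

/-- `‖φ‖_WP² = Var(φ, m_{-l}) / ∫ l dm_{-l}` for a tangent vector `φ` at `l`. -/
def wpNormSq (G : FinGraph V k) (l φ : Fin k → ℝ) : ℝ :=
  G.asympVar (G.onShift φ) (G.eqState l) / ∫ x, G.onShift l x ∂(G.eqState l)

def wpNorm (G : FinGraph V k) (l φ : Fin k → ℝ) : ℝ := √(G.wpNormSq l φ)

/-- `γ` restricts to a continuously differentiable curve `[0, 1] → entropyOne` from `l₁` to `l₂`. -/
def IsCurve (G : FinGraph V k) (l₁ l₂ : Fin k → ℝ) (γ : ℝ → Fin k → ℝ) : Prop :=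
  ContDiffOn ℝ 1 γ (Icc 0 1) ∧ (∀ t ∈ Icc (0 : ℝ) 1, γ t ∈ G.entropyOne) ∧ γ 0 = l₁ ∧ γ 1 = l₂

/-- The Weil-Petersson length of a curve. -/
def wpLength (G : FinGraph V k) (γ : ℝ → Fin k → ℝ) : ENNReal :=
  ∫⁻ t in Icc (0 : ℝ) 1, ENNReal.ofReal (G.wpNorm (γ t) (derivWithin γ (Icc 0 1) t))

/-- The Weil-Petersson path distance. -/
def wpDist (G : FinGraph V k) (l₁ l₂ : Fin k → ℝ) : ENNReal :=
  ⨅ (γ : ℝ → Fin k → ℝ) (_ : G.IsCurve l₁ l₂ γ), G.wpLength γ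

end FinGraph

/-- The figure-8 graph: one vertex and two loops. -/
def figureEight : FinGraph Unit 2 where
  src := fun _ => ()
  tgt := fun _ => ()

/-- The curve `c(x) = (x, -log ((1 - e^{-x}) / (1 + 3 e^{-x})))`. -/
def figureEightCurve (x : ℝ) : Fin 2 → ℝ :=
  ![x, -Real.log ((1 - Real.exp (-x)) / (1 + 3 * Real.exp (-x)))]

/-- `f ≍ g` along the filter `F`. -/
def Comparable (F : Filter ℝ) (f g : ℝ → ℝ) : Prop :=
  ∃ c c' : ℝ, 0 < c ∧ 0 < c' ∧ ∀ᶠ x in F, c < f x / g x ∧ f x / g x < c'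

end

/-! Write X and Y for exp(-l) on the two loops. On functions of the undirected initial edge the
transfer operator of -l is the matrix with rows (X, 2Y) and (2X, Y), so everything is explicit. It
has eigenvalue 1 exactly when X + Y + 3XY = 1 (`Critical`), and then the other eigenvalue is X + Y -
1 (`rate`).

Criticality means entropy one. For critical l, `edgeMass l e * exp T` solves the homogeneous form of
the renewal equation for the number of walks from e of length less than T, so that number lies
between multiples of exp T (`le_ncard_walks`, `ncard_walks_le`), and closed cycles are as numerous
as walks up to a bounded change of T. Every positive l has a critical multiple s l, and scaling then
gives h(l) = s; so entropy one forces criticality (`mem_entropyOne_iff`).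

The conformal measure is the law of a Markov chain. It is unique because conformality fixes the
masses of the initial edges and then, step by step, all integrals (`IsConformal.unique`); the
eigenfunction is unique by a maximum principle (`eigenfunction_unique`). For a centered edge
function each shift multiplies the correlations by r = `rate l`, so the variance is (1 + r)/(1 - r)
times the second moment (`tendsto_varSeq`). This yields the closed form `speedSq` for the squared
speed of the curve.

The moduli space is one-dimensional, so the path distance is the difference of arc lengths
(`wpDist_curve`). The speed is asymptotic to 1/(x √(-log x)) at 0 and to 1/√x at infinity, and
neither is integrable there. Hence arc length maps the space isometrically onto the real line, which
gives the metric, its completeness and the infinite distance of both ends. -/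

noncomputable section

/-! ### The transfer operator as a finite sum over prepended edges -/

namespace FinGraph

variable {V : Type} {k : ℕ} (G : FinGraph V k)

open Classical in
/-- Prepend the directed edge `e` to the path `x` (and return `x` if this is not admissible). -/
def prepend (e : DirEdge k) (x : G.Shift) : G.Shift :=
  if h : G.Adj e (x.1 0) then
    ⟨fun n => Nat.casesOn n e x.1, fun n => by cases n with
      | zero => exact h
      | succ n => exact x.2 n⟩
  else x

variable {G}

theorem prepend_zero {e : DirEdge k} {x : G.Shift} (h : G.Adj e (x.1 0)) :
    (G.prepend e x).1 0 = e := by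
  simp [prepend, h]

theorem prepend_succ {e : DirEdge k} {x : G.Shift} (h : G.Adj e (x.1 0)) (n : ℕ) :
    (G.prepend e x).1 (n + 1) = x.1 n := by
  simp [prepend, h]

theorem shift_prepend {e : DirEdge k} {x : G.Shift} (h : G.Adj e (x.1 0)) :
    G.shift (G.prepend e x) = x := by
  apply Subtype.ext
  funext n
  exact prepend_succ h n

theorem prepend_shift (y : G.Shift) : G.prepend (y.1 0) (G.shift y) = y := by
  have h : G.Adj (y.1 0) ((G.shift y).1 0) := y.2 0
  apply Subtype.ext
  funext n
  cases n with
  | zero => exact prepend_zero h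
  | succ n => exact prepend_succ h n

open Classical in
/-- The transfer operator as a sum over the edges that may precede `x`. -/
theorem transfer_eq_sum (f w : G.Shift → ℝ) (x : G.Shift) :
    G.transfer f w x = ∑ e : DirEdge k, if G.Adj e (x.1 0) then
      Real.exp (f (G.prepend e x)) * w (G.prepend e x) else 0 := by
  have hset : {y : G.Shift | G.shift y = x} =
      range (fun e : {e : DirEdge k // G.Adj e (x.1 0)} => G.prepend e.1 x) := by
    ext y
    constructor
    · rintro rfl
      exact ⟨⟨y.1 0, y.2 0⟩, prepend_shift y⟩
    · rintro ⟨e, rfl⟩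
      exact shift_prepend e.2
  have hinj : Function.Injective
      (fun e : {e : DirEdge k // G.Adj e (x.1 0)} => G.prepend e.1 x) := by
    intro e e' h
    have := congrArg (fun z : G.Shift => z.1 0) h
    simp only [prepend_zero e.2, prepend_zero e'.2] at this
    exact Subtype.ext this
  have h1 : G.transfer f w x =
      ∑ᶠ y ∈ {y : G.Shift | G.shift y = x}, Real.exp (f y) * w y := rfl
  rw [h1, hset, finsum_mem_range hinj, finsum_eq_sum_of_fintype, ← Finset.sum_filter,
    ← Finset.sum_subtype_eq_sum_filter]
  refine Finset.sum_bij (fun e _ => ⟨e.1, e.2⟩) ?_ ?_ ?_ ?_ <;> simp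

theorem continuous_coord (n : ℕ) : Continuous (fun x : G.Shift => x.1 n) :=
  (continuous_apply n).comp continuous_subtype_val

theorem continuous_shift : Continuous G.shift :=
  Continuous.subtype_mk (continuous_pi fun n => continuous_coord (n + 1)) _

theorem continuous_onShift (φ : Fin k → ℝ) : Continuous (G.onShift φ) :=
  (continuous_of_discreteTopology (f := fun e : DirEdge k => φ e.1)).comp (continuous_coord 0)

/-- Each coordinate of the result depends on at most three coordinates of `x`, in the inadmissible
branch too, and so factors through a finite discrete space. -/
theorem continuous_prepend (e : DirEdge k) : Continuous (G.prepend e) := by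
  classical
  refine Continuous.subtype_mk (f := fun x => (G.prepend e x).1) (continuous_pi fun n => ?_) _
  cases n with
  | zero =>
    have : (fun x : G.Shift => (G.prepend e x).1 0) =
        fun x => (fun d => if G.Adj e d then e else d) (x.1 0) := by
      funext x
      by_cases h : G.Adj e (x.1 0) <;> simp [prepend, h]
    rw [this]
    exact (continuous_of_discreteTopology (f := fun d => if G.Adj e d then e else d)).comp
      (continuous_coord 0)
  | succ n =>
    have : (fun x : G.Shift => (G.prepend e x).1 (n + 1)) =
        fun x => (fun d : DirEdge k × DirEdge k × DirEdge k =>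
          if G.Adj e d.1 then d.2.1 else d.2.2) (x.1 0, x.1 n, x.1 (n + 1)) := by
      funext x
      by_cases h : G.Adj e (x.1 0) <;> simp [prepend, h]
    rw [this]
    exact (continuous_of_discreteTopology (f := fun d : DirEdge k × DirEdge k × DirEdge k =>
      if G.Adj e d.1 then d.2.1 else d.2.2)).comp
      ((continuous_coord 0).prodMk ((continuous_coord n).prodMk (continuous_coord (n + 1))))

theorem continuous_transfer {f w : G.Shift → ℝ} (hf : Continuous f) (hw : Continuous w) :
    Continuous (G.transfer f w) := by
  classical
  rw [show G.transfer f w = fun x => _ from funext (transfer_eq_sum f w)]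
  refine continuous_finsetSum _ fun e _ => ?_
  have : (fun x : G.Shift => if G.Adj e (x.1 0) then
      Real.exp (f (G.prepend e x)) * w (G.prepend e x) else 0) = fun x =>
      (fun d => if G.Adj e d then (1 : ℝ) else 0) (x.1 0) *
        (Real.exp (f (G.prepend e x)) * w (G.prepend e x)) := by
    funext x
    by_cases h : G.Adj e (x.1 0) <;> simp [h]
  rw [this]
  exact ((continuous_of_discreteTopology (f := fun d => if G.Adj e d then (1 : ℝ) else 0)).comp
    (continuous_coord 0)).mul ((Real.continuous_exp.comp (hf.comp (continuous_prepend e))).mul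
      (hw.comp (continuous_prepend e)))

instance compactSpace_shift : CompactSpace G.Shift := by
  apply isCompact_iff_compactSpace.mp
  apply IsClosed.isCompact
  have : {x : ℕ → DirEdge k | ∀ n, G.Adj (x n) (x (n + 1))} =
      ⋂ n, (fun x : ℕ → DirEdge k => (x n, x (n + 1))) ⁻¹' {p | G.Adj p.1 p.2} := by
    ext x; simp
  show IsClosed {x : ℕ → DirEdge k | ∀ n, G.Adj (x n) (x (n + 1))}
  rw [this]
  exact isClosed_iInter fun n => (isClosed_discrete _).preimage
    ((continuous_apply n).prodMk (continuous_apply (n + 1)))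

theorem integrable_of_continuous (μ : Measure G.Shift) [IsFiniteMeasure μ] {g : G.Shift → ℝ}
    (hg : Continuous g) : Integrable g μ :=
  hg.integrable_of_hasCompactSupport (HasCompactSupport.of_compactSpace g)

theorem transfer_const_mul (f w : G.Shift → ℝ) (c : ℝ) (x : G.Shift) :
    G.transfer f (fun y => c * w y) x = c * G.transfer f w x := by
  classical
  simp only [transfer_eq_sum, Finset.mul_sum]
  refine Finset.sum_congr rfl fun e _ => ?_
  split_ifs <;> ring

/-- The transfer operator is linear over functions pulled back by the shift. -/
theorem transfer_mul_comp_shift (f w u : G.Shift → ℝ) (x : G.Shift) :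
    G.transfer f (fun y => w y * u (G.shift y)) x = G.transfer f w x * u x := by
  classical
  simp only [transfer_eq_sum, Finset.sum_mul]
  refine Finset.sum_congr rfl fun e _ => ?_
  split_ifs with h
  · rw [shift_prepend h]; ring
  · ring

end FinGraph

/-! ### The conformal measure as the law of a Markov chain -/

/-- An infinite power of a probability measure is invariant under adding a coordinate in front. -/
theorem infinitePi_map_natCons {S : Type*} [MeasurableSpace S] (ρ : Measure S)
    [IsProbabilityMeasure ρ] :
    (ρ.prod (Measure.infinitePi fun _ : ℕ => ρ)).map
      (fun p n => Nat.casesOn (motive := fun _ => S) n p.1 p.2) =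
      Measure.infinitePi fun _ : ℕ => ρ := by
  classical
  have hmeas : Measurable (fun (p : S × (ℕ → S)) (n : ℕ) =>
      Nat.casesOn (motive := fun _ => S) n p.1 p.2) := by
    refine measurable_pi_lambda _ fun n => ?_
    cases n with
    | zero => exact measurable_fst
    | succ n => exact (measurable_pi_apply n).comp measurable_snd
  apply Measure.eq_infinitePi
  intro s t ht
  obtain ⟨N, hN⟩ : ∃ N, s ⊆ Finset.range (N + 1) :=
    ⟨s.sup id, fun i hi => Finset.mem_range.mpr (Nat.lt_succ_of_le (Finset.le_sup (f := id) hi))⟩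
  -- Padding the cylinder with `univ` makes its index set an initial segment, so that its preimage
  -- is a product of `t' 0` and a shifted cylinder.
  set t' : ℕ → Set S := fun i => if i ∈ s then t i else univ with ht'
  have ht'm : ∀ i, MeasurableSet (t' i) := fun i => by
    by_cases h : i ∈ s <;> simp [ht', h, ht]
  have h1 : Set.pi (s : Set ℕ) t = Set.pi (Finset.range (N + 1) : Set ℕ) t' := by
    ext x
    simp only [Set.mem_pi, Finset.mem_coe]
    constructor
    · intro h i _
      by_cases his : i ∈ s
      · simpa [ht', his] using h i his
      · simp [ht', his]
    · intro h i hi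
      simpa [ht', hi] using h i (hN hi)
  have h2 : ∏ i ∈ s, ρ (t i) = ∏ i ∈ Finset.range (N + 1), ρ (t' i) := by
    rw [← Finset.prod_subset hN]
    · exact Finset.prod_congr rfl fun i hi => by simp [ht', hi]
    · intro i _ hi
      simp [ht', hi]
  rw [h1, h2, Measure.map_apply hmeas
    (MeasurableSet.pi (Finset.countable_toSet _) fun i _ => ht'm i)]
  have h3 : (fun (p : S × (ℕ → S)) (n : ℕ) => Nat.casesOn (motive := fun _ => S) n p.1 p.2) ⁻¹'
      Set.pi (Finset.range (N + 1) : Set ℕ) t' =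
      t' 0 ×ˢ Set.pi (Finset.range N : Set ℕ) (fun i => t' (i + 1)) := by
    ext ⟨a, b⟩
    simp only [Set.mem_preimage, Set.mem_pi, Finset.coe_range, Set.mem_Iio, Set.mem_prod]
    constructor
    · intro h
      exact ⟨h 0 (by omega), fun i hi => h (i + 1) (by omega)⟩
    · rintro ⟨h0, h⟩ i hi
      cases i with
      | zero => exact h0
      | succ i => exact h i (by omega)
  rw [h3, Measure.prod_prod, Measure.infinitePi_pi _ (fun i _ => ht'm (i + 1)),
    Finset.prod_range_succ']
  ring

theorem DirEdge.ne_bar {k : ℕ} (e : DirEdge k) : e ≠ e.bar := by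
  intro h
  have := congrArg Prod.snd h
  simp [DirEdge.bar] at this

theorem DirEdge.bar_bar {k : ℕ} (e : DirEdge k) : e.bar.bar = e := by
  simp [DirEdge.bar]

namespace FigureEight

theorem adj_iff (e e' : DirEdge 2) : figureEight.Adj e e' ↔ e' ≠ e.bar := by
  simp [FinGraph.Adj, FinGraph.origin, FinGraph.terminus, figureEight]

theorem adj_self (e : DirEdge 2) : figureEight.Adj e e := (adj_iff e e).2 e.ne_bar

/-- Two successive steps connect any two directed edges. -/
theorem exists_adj_adj (e e' : DirEdge 2) : ∃ d, figureEight.Adj e d ∧ figureEight.Adj d e' := by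
  simp only [adj_iff]
  revert e e'
  decide

/-- The mass which the conformal measure of `-l` gives to the paths starting with `e`. -/
def edgeMass (l : Fin 2 → ℝ) (e : DirEdge 2) : ℝ :=
  Real.exp (-l e.1) / (1 + Real.exp (-l e.1))

theorem edgeMass_pos (l : Fin 2 → ℝ) (e : DirEdge 2) : 0 < edgeMass l e := by
  unfold edgeMass; positivity

theorem edgeMass_bar (l : Fin 2 → ℝ) (e : DirEdge 2) : edgeMass l e.bar = edgeMass l e := rfl

theorem sum_edgeMass (l : Fin 2 → ℝ) :
    ∑ e, edgeMass l e = 2 * edgeMass l (0, true) + 2 * edgeMass l (1, true) := by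
  have h (i : Fin 2) : edgeMass l (i, false) = edgeMass l (i, true) := rfl
  simp only [Fintype.sum_prod_type, Fin.sum_univ_two, Fintype.sum_bool, h]
  ring

/-- The equation of the moduli space. -/
def Critical (l : Fin 2 → ℝ) : Prop :=
  1 - Real.exp (-l 0) - Real.exp (-l 1) - 3 * Real.exp (-l 0) * Real.exp (-l 1) = 0

variable {l : Fin 2 → ℝ}

theorem Critical.sum_edgeMass (h : Critical l) : ∑ e, edgeMass l e = 1 := by
  rw [FigureEight.sum_edgeMass]
  unfold Critical at h
  simp only [edgeMass]
  have := Real.exp_pos (-l 0)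
  have := Real.exp_pos (-l 1)
  field_simp
  linarith

open Classical in
/-- Transition probabilities of the conformal measure. -/
def transition (l : Fin 2 → ℝ) (e e' : DirEdge 2) : ℝ :=
  if figureEight.Adj e e' then (1 + Real.exp (-l e.1)) * edgeMass l e' else 0

theorem transition_nonneg (l : Fin 2 → ℝ) (e e' : DirEdge 2) : 0 ≤ transition l e e' := by
  unfold transition
  have := edgeMass_pos l e'
  split_ifs <;> positivity

theorem sum_adj_eq (g : DirEdge 2 → ℝ) (e : DirEdge 2) [DecidablePred (figureEight.Adj e)] :
    ∑ e', (if figureEight.Adj e e' then g e' else 0) = ∑ e', g e' - g e.bar := by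
  rw [eq_sub_iff_add_eq, ← Finset.sum_filter_add_sum_filter_not Finset.univ (figureEight.Adj e) g,
    Finset.sum_filter, show Finset.univ.filter (fun x => ¬ figureEight.Adj e x) = {e.bar} by
      ext x; simp [adj_iff], Finset.sum_singleton]

theorem sum_transition (h : Critical l) (e : DirEdge 2) : ∑ e', transition l e e' = 1 := by
  unfold transition
  rw [sum_adj_eq, ← Finset.mul_sum, h.sum_edgeMass, edgeMass_bar]
  unfold edgeMass
  have := Real.exp_pos (-l e.1)
  field_simp
  ring

/-- This balance is conformality on cylinders: prepending `e` multiplies mass by exp(-l e). The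
factor 1 + exp(-l e) in `transition` is chosen for it. -/
theorem edgeMass_mul_transition (l : Fin 2 → ℝ) {e e' : DirEdge 2} (h : figureEight.Adj e e') :
    edgeMass l e * transition l e e' = Real.exp (-l e.1) * edgeMass l e' := by
  rw [transition, if_pos h, edgeMass]
  have := Real.exp_pos (-l e.1)
  field_simp

/-- The law of the successor of `e`. -/
def succLaw (l : Fin 2 → ℝ) (e : DirEdge 2) : Measure (DirEdge 2) :=
  ∑ e', ENNReal.ofReal (transition l e e') • Measure.dirac e'

theorem isProbabilityMeasure_succLaw (h : Critical l) (e : DirEdge 2) :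
    IsProbabilityMeasure (succLaw l e) := by
  constructor
  simp only [succLaw, Measure.coe_finsetSum, Measure.coe_smul, Finset.sum_apply, Pi.smul_apply,
    measure_univ, smul_eq_mul, mul_one]
  rw [← ENNReal.ofReal_sum_of_nonneg fun e' _ => transition_nonneg l e e', sum_transition h]
  simp

theorem integral_succLaw (e : DirEdge 2) (g : DirEdge 2 → ℝ) :
    ∫ d, g d ∂(succLaw l e) = ∑ e', transition l e e' * g e' := by
  rw [succLaw, integral_finsetSum_measure]
  · refine Finset.sum_congr rfl fun e' _ => ?_
    rw [integral_smul_measure, integral_dirac, ENNReal.toReal_ofReal (transition_nonneg l e e'),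
      smul_eq_mul]
  · intro e' _
    exact (integrable_dirac (by simp)).smul_measure ENNReal.ofReal_ne_top

open Classical in
/-- The successor of `e` prescribed by `g`, if it is admissible. -/
def step (e : DirEdge 2) (g : DirEdge 2 → DirEdge 2) : DirEdge 2 :=
  if figureEight.Adj e (g e) then g e else e

theorem adj_step (e : DirEdge 2) (g : DirEdge 2 → DirEdge 2) : figureEight.Adj e (step e g) := by
  unfold step
  split_ifs with h
  exacts [h, adj_self e]

/-- The path from `e` which follows the successor prescriptions `ω 0, ω 1, …`. -/
def path (e : DirEdge 2) (ω : ℕ → DirEdge 2 → DirEdge 2) : figureEight.Shift :=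
  ⟨fun n => Nat.rec e (fun i d => step d (ω i)) n, fun n => adj_step _ (ω n)⟩

/-- The Markov property on the level of paths: the first prescription is used for one step, and the
remaining ones drive the path from there. -/
theorem path_natCons (e : DirEdge 2) (g : DirEdge 2 → DirEdge 2)
    (ω : ℕ → DirEdge 2 → DirEdge 2) :
    path e (fun n => Nat.casesOn n g ω) = figureEight.prepend e (path (step e g) ω) := by
  have h : figureEight.Adj e ((path (step e g) ω).1 0) := adj_step e g
  apply Subtype.ext
  funext n
  cases n with
  | zero => rw [FinGraph.prepend_zero h]; rfl
  | succ n =>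
    rw [FinGraph.prepend_succ h]
    induction n with
    | zero => rfl
    | succ n ih => exact congrArg (fun d => step d (ω n)) ih

theorem measurable_path (e : DirEdge 2) : Measurable (path e) := by
  refine Measurable.subtype_mk (measurable_pi_lambda _ fun n => ?_)
  induction n with
  | zero => exact measurable_const
  | succ n ih =>
    have h : Measurable (fun p : DirEdge 2 × (DirEdge 2 → DirEdge 2) => step p.1 p.2) :=
      measurable_of_countable _
    exact h.comp (ih.prodMk (measurable_pi_apply n))

/-- The law of independent successor prescriptions. -/
def driver (l : Fin 2 → ℝ) : Measure (ℕ → DirEdge 2 → DirEdge 2) :=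
  Measure.infinitePi fun _ => Measure.pi (succLaw l)

theorem isProbabilityMeasure_driver (h : Critical l) : IsProbabilityMeasure (driver l) := by
  have := isProbabilityMeasure_succLaw h
  unfold driver
  infer_instance

/-- Only the coordinate `e` of the random prescription matters. Inadmissible successors have
probability zero, so the fallback in `step` does not contribute. -/
theorem integral_pi_succLaw (h : Critical l) (e : DirEdge 2) (g : DirEdge 2 → ℝ) :
    ∫ d, g (step e d) ∂(Measure.pi (succLaw l)) = ∑ e', transition l e e' * g e' := by
  classical
  have := isProbabilityMeasure_succLaw h
  have h1 := (measurePreserving_eval (succLaw l) e).map_eq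
  have h2 : ∫ d, g (if figureEight.Adj e d then d else e) ∂(succLaw l e) =
      ∫ d, g (step e d) ∂(Measure.pi (succLaw l)) := by
    rw [← h1, integral_map (measurable_pi_apply e).aemeasurable]
    · simp only [step]
    · exact (measurable_of_countable _).aestronglyMeasurable
  rw [← h2, integral_succLaw]
  refine Finset.sum_congr rfl fun e' _ => ?_
  by_cases h' : figureEight.Adj e e'
  · simp [h']
  · simp [transition, h']

/-- First-step analysis: the law of the prescriptions is unchanged when an independent one is put in
front, and `path_natCons` then isolates the first transition. -/
theorem integral_driver (h : Critical l) {φ : figureEight.Shift → ℝ} (hφ : Continuous φ)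
    (e : DirEdge 2) :
    ∫ ω, φ (path e ω) ∂(driver l) =
      ∑ e', transition l e e' * ∫ ω, φ (figureEight.prepend e (path e' ω)) ∂(driver l) := by
  have := isProbabilityMeasure_succLaw h
  have := isProbabilityMeasure_driver h
  have hb : ∃ C, ∀ x, ‖φ x‖ ≤ C := by
    obtain ⟨C, hC⟩ := isCompact_univ.exists_bound_of_continuousOn hφ.continuousOn
    exact ⟨C, fun x => hC x (mem_univ x)⟩
  obtain ⟨C, hC⟩ := hb
  have hm : Measurable (fun (p : (DirEdge 2 → DirEdge 2) × (ℕ → DirEdge 2 → DirEdge 2)) (n : ℕ) =>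
      Nat.casesOn (motive := fun _ => DirEdge 2 → DirEdge 2) n p.1 p.2) := by
    refine measurable_pi_lambda _ fun n => ?_
    cases n with
    | zero => exact measurable_fst
    | succ n => exact (measurable_pi_apply n).comp measurable_snd
  have hφm : Measurable (fun ω => φ (path e ω)) := hφ.measurable.comp (measurable_path e)
  conv_lhs => rw [driver, ← infinitePi_map_natCons]
  rw [integral_map hm.aemeasurable hφm.aestronglyMeasurable, integral_prod]
  · refine (integral_congr_ae (ae_of_all _ fun g => integral_congr_ae (ae_of_all _ fun ω =>
      congrArg φ (path_natCons e g ω)))).trans ?_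
    exact integral_pi_succLaw h e
      (fun d => ∫ ω, φ (figureEight.prepend e (path d ω)) ∂(driver l))
  · exact Integrable.of_bound (hφm.comp hm).aestronglyMeasurable C (ae_of_all _ fun p => hC _)

/-- The conformal measure of `-l`. -/
def conformal (l : Fin 2 → ℝ) : Measure figureEight.Shift :=
  ∑ e, ENNReal.ofReal (edgeMass l e) • (driver l).map (path e)

theorem isProbabilityMeasure_conformal (h : Critical l) :
    IsProbabilityMeasure (conformal l) := by
  have := isProbabilityMeasure_driver h
  have (e : DirEdge 2) : IsProbabilityMeasure ((driver l).map (path e)) :=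
    Measure.isProbabilityMeasure_map (measurable_path e).aemeasurable
  constructor
  simp only [conformal, Measure.coe_finsetSum, Measure.coe_smul, Finset.sum_apply, Pi.smul_apply,
    measure_univ, smul_eq_mul, mul_one]
  rw [← ENNReal.ofReal_sum_of_nonneg fun e _ => (edgeMass_pos l e).le, h.sum_edgeMass]
  simp

theorem integral_conformal (h : Critical l) {φ : figureEight.Shift → ℝ} (hφ : Continuous φ) :
    ∫ x, φ x ∂(conformal l) = ∑ e, edgeMass l e * ∫ ω, φ (path e ω) ∂(driver l) := by
  have := isProbabilityMeasure_driver h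
  have (e : DirEdge 2) : IsProbabilityMeasure ((driver l).map (path e)) :=
    Measure.isProbabilityMeasure_map (measurable_path e).aemeasurable
  rw [conformal, integral_finsetSum_measure]
  · refine Finset.sum_congr rfl fun e _ => ?_
    rw [integral_smul_measure, ENNReal.toReal_ofReal (edgeMass_pos l e).le, smul_eq_mul,
      integral_map (measurable_path e).aemeasurable hφ.measurable.aestronglyMeasurable]
  · intro e _
    exact (FinGraph.integrable_of_continuous _ hφ).smul_measure ENNReal.ofReal_ne_top

/-- Both sides become double sums over admissible pairs (e, e') after expanding the operator on the
left and the first step of the chain on the right. They agree term by term by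
`edgeMass_mul_transition`. -/
theorem integral_transfer_conformal (h : Critical l) {φ : figureEight.Shift → ℝ}
    (hφ : Continuous φ) :
    ∫ x, figureEight.transfer (fun x => -figureEight.onShift l x) φ x ∂(conformal l) =
      ∫ x, φ x ∂(conformal l) := by
  classical
  have := isProbabilityMeasure_driver h
  have hpot : Continuous (fun x => -figureEight.onShift l x) :=
    (FinGraph.continuous_onShift l).neg
  rw [integral_conformal h hφ, integral_conformal h (FinGraph.continuous_transfer hpot hφ)]
  have hint (e e' : DirEdge 2) :
      Integrable (fun ω => φ (figureEight.prepend e (path e' ω))) (driver l) := by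
    have (e : DirEdge 2) : IsProbabilityMeasure ((driver l).map (path e)) :=
      Measure.isProbabilityMeasure_map (measurable_path e).aemeasurable
    exact (FinGraph.integrable_of_continuous ((driver l).map (path e'))
      (hφ.comp (FinGraph.continuous_prepend e))).comp_measurable (measurable_path e')
  have hL (e' : DirEdge 2) : ∫ ω, figureEight.transfer (fun x => -figureEight.onShift l x) φ
      (path e' ω) ∂(driver l) = ∑ e, if figureEight.Adj e e' then Real.exp (-l e.1) *
        ∫ ω, φ (figureEight.prepend e (path e' ω)) ∂(driver l) else 0 := by
    have h0 (ω) : (path e' ω).1 0 = e' := rfl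
    have h1 (ω) : figureEight.transfer (fun x => -figureEight.onShift l x) φ (path e' ω) =
        ∑ e, if figureEight.Adj e e' then Real.exp (-l e.1) *
          φ (figureEight.prepend e (path e' ω)) else 0 := by
      rw [FinGraph.transfer_eq_sum]
      refine Finset.sum_congr rfl fun e _ => ?_
      rw [h0]
      split_ifs with hadj
      · rw [FinGraph.onShift, FinGraph.prepend_zero (by rwa [h0])]
      · rfl
    simp only [h1]
    rw [integral_finsetSum]
    · refine Finset.sum_congr rfl fun e _ => ?_
      split_ifs
      · rw [integral_const_mul]
      · simp
    · intro e _
      split_ifs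
      · exact (hint e e').const_mul _
      · exact integrable_zero _ _ _
  simp only [hL, integral_driver h hφ, Finset.mul_sum]
  rw [Finset.sum_comm]
  refine Finset.sum_congr rfl fun e _ => Finset.sum_congr rfl fun e' _ => ?_
  split_ifs with hadj
  · rw [← mul_assoc, ← mul_assoc, edgeMass_mul_transition l hadj, mul_comm (edgeMass l e')]
  · simp [transition, hadj]

end FigureEight

/-! ### Uniqueness of the equilibrium state -/

namespace FigureEight

variable {l : Fin 2 → ℝ}

theorem adj_comm {e e' : DirEdge 2} : figureEight.Adj e e' ↔ figureEight.Adj e' e := by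
  rw [adj_iff, adj_iff]
  constructor <;> rintro h rfl <;> exact h (DirEdge.bar_bar _).symm

theorem continuous_potential (l : Fin 2 → ℝ) :
    Continuous (fun x => -figureEight.onShift l x) :=
  (FinGraph.continuous_onShift l).neg

theorem continuous_edgeFun (g : DirEdge 2 → ℝ) :
    Continuous (fun x : figureEight.Shift => g (x.1 0)) :=
  (continuous_of_discreteTopology (f := g)).comp (FinGraph.continuous_coord 0)

/-- The transfer operator on functions of the initial directed edge. -/
theorem transfer_edgeFun (l : Fin 2 → ℝ) (g : DirEdge 2 → ℝ) (x : figureEight.Shift) :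
    figureEight.transfer (fun x => -figureEight.onShift l x) (fun y => g (y.1 0)) x =
      ∑ e, Real.exp (-l e.1) * g e - Real.exp (-l (x.1 0).1) * g (x.1 0).bar := by
  classical
  have h := sum_adj_eq (fun e => Real.exp (-l e.1) * g e) (x.1 0)
  rw [FinGraph.transfer_eq_sum]
  refine Eq.trans (Finset.sum_congr rfl fun e _ => ?_) h
  rw [adj_comm (e := x.1 0)]
  split_ifs with hadj
  · rw [FinGraph.onShift, FinGraph.prepend_zero hadj]
  · rfl

theorem transfer_onShift (l g : Fin 2 → ℝ) (x : figureEight.Shift) :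
    figureEight.transfer (fun x => -figureEight.onShift l x) (figureEight.onShift g) x =
      2 * (Real.exp (-l 0) * g 0 + Real.exp (-l 1) * g 1) -
        Real.exp (-l (x.1 0).1) * g (x.1 0).1 := by
  refine (transfer_edgeFun l (fun e => g e.1) x).trans ?_
  simp only [Fintype.sum_prod_type, Fin.sum_univ_two, Fintype.sum_bool, DirEdge.bar]
  ring

/-- The eigenfunction of the transfer operator of `-l`. -/
def density (l : Fin 2 → ℝ) (i : Fin 2) : ℝ := 1 / (1 + Real.exp (-l i))

theorem density_pos (l : Fin 2 → ℝ) (i : Fin 2) : 0 < density l i := by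
  unfold density; positivity

/-- Criticality says precisely that the full sum over all edges equals 1; removing the forbidden
reversed edge leaves 1 - t/(1 + t) = 1/(1 + t) with t = exp(-l e). -/
theorem transfer_density (h : Critical l) (x : figureEight.Shift) :
    figureEight.transfer (fun x => -figureEight.onShift l x)
      (figureEight.onShift (density l)) x = figureEight.onShift (density l) x := by
  rw [transfer_onShift, FinGraph.onShift]
  unfold Critical at h
  have h0 := Real.exp_pos (-l 0)
  have h1 := Real.exp_pos (-l 1)
  have key : 2 * (Real.exp (-l 0) * density l 0 + Real.exp (-l 1) * density l 1) = 1 := by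
    unfold density
    field_simp
    linarith
  rw [key, density]
  have := Real.exp_pos (-l (x.1 0).1)
  field_simp
  ring

/-- A probability measure fixed by the dual of the transfer operator of `-l`. -/
def IsConformal (l : Fin 2 → ℝ) (μ : Measure figureEight.Shift) : Prop :=
  IsProbabilityMeasure μ ∧ ∀ φ : C(figureEight.Shift, ℝ),
    ∫ x, figureEight.transfer (fun x => -figureEight.onShift l x) φ x ∂μ = ∫ x, φ x ∂μ

theorem IsConformal.integral_transfer {μ : Measure figureEight.Shift} (hμ : IsConformal l μ)
    {φ : figureEight.Shift → ℝ} (hφ : Continuous φ) :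
    ∫ x, figureEight.transfer (fun x => -figureEight.onShift l x) φ x ∂μ = ∫ x, φ x ∂μ :=
  hμ.2 ⟨φ, hφ⟩

theorem isConformal_conformal (h : Critical l) : IsConformal l (conformal l) :=
  ⟨isProbabilityMeasure_conformal h, fun φ => integral_transfer_conformal h φ.continuous⟩

open Classical in
/-- A conformal measure gives mass `edgeMass l e` to the paths starting with `e`. -/
theorem IsConformal.integral_indicator (hl : ∀ i, 0 < l i) {μ : Measure figureEight.Shift}
    (hμ : IsConformal l μ) (e : DirEdge 2) :
    ∫ x, (if x.1 0 = e then (1 : ℝ) else 0) ∂μ = edgeMass l e := by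
  have := hμ.1
  -- Only the reverse of `e` cannot follow `e`. The equations for `e` and for its reverse form a
  -- linear system with determinant 1 - t², which is nonzero because l is positive.
  have key (e : DirEdge 2) : ∫ x, (if x.1 0 = e then (1 : ℝ) else 0) ∂μ =
      Real.exp (-l e.1) * (1 - ∫ x, (if x.1 0 = e.bar then (1 : ℝ) else 0) ∂μ) := by
    rw [← hμ.integral_transfer (continuous_edgeFun fun d => if d = e then (1 : ℝ) else 0)]
    have h1 (x : figureEight.Shift) : (∑ d : DirEdge 2, Real.exp (-l d.1) *
        (if d = e then (1 : ℝ) else 0)) - Real.exp (-l (x.1 0).1) *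
          (if (x.1 0).bar = e then (1 : ℝ) else 0) =
        Real.exp (-l e.1) * (1 - if x.1 0 = e.bar then (1 : ℝ) else 0) := by
      have : (x.1 0).bar = e ↔ x.1 0 = e.bar := by
        constructor <;> intro h
        · rw [← h, DirEdge.bar_bar]
        · rw [h, DirEdge.bar_bar]
      simp only [this]
      by_cases hx : x.1 0 = e.bar
      · simp [hx, DirEdge.bar]
      · simp [hx]
    refine (integral_congr_ae (ae_of_all _ fun x => (transfer_edgeFun l
      (fun d => if d = e then (1 : ℝ) else 0) x).trans (h1 x))).trans ?_
    rw [integral_const_mul, integral_sub (integrable_const _), integral_const]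
    · simp
    · exact FinGraph.integrable_of_continuous μ
        (continuous_edgeFun fun d => if d = e.bar then (1 : ℝ) else 0)
  have h1 := key e
  have h2 := key e.bar
  rw [DirEdge.bar_bar, show (e.bar).1 = e.1 from rfl] at h2
  rw [h2] at h1
  have ht0 := Real.exp_pos (-l e.1)
  have ht1 : Real.exp (-l e.1) < 1 := Real.exp_lt_one_iff.2 (by linarith [hl e.1])
  set t := Real.exp (-l e.1) with ht
  set I := ∫ x, (if x.1 0 = e then (1 : ℝ) else 0) ∂μ
  rw [edgeMass, ← ht, eq_div_iff (by positivity)]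
  have : (1 - t) * (I * (1 + t)) = (1 - t) * t := by linear_combination h1
  exact mul_left_cancel₀ (by linarith) this

theorem IsConformal.integral_edgeFun (hl : ∀ i, 0 < l i) {μ : Measure figureEight.Shift}
    (hμ : IsConformal l μ) (g : DirEdge 2 → ℝ) :
    ∫ x, g (x.1 0) ∂μ = ∑ e, g e * edgeMass l e := by
  classical
  have := hμ.1
  have h1 (x : figureEight.Shift) : g (x.1 0) = ∑ e, g e * (if x.1 0 = e then (1 : ℝ) else 0) := by
    simp
  simp only [h1]
  rw [integral_finsetSum]
  · refine Finset.sum_congr rfl fun e _ => ?_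
    rw [integral_const_mul, hμ.integral_indicator hl]
  · intro e _
    exact (FinGraph.integrable_of_continuous μ
        (continuous_edgeFun fun d => if d = e then (1 : ℝ) else 0)).const_mul _

/-- The path which follows `x` up to time `n` and repeats its `n`-th edge from then on. -/
def freeze (n : ℕ) (x : figureEight.Shift) : figureEight.Shift :=
  ⟨fun i => x.1 (min i n), fun i => by
    rcases lt_or_ge i n with h | h
    · beta_reduce
      rw [min_eq_left h.le, min_eq_left (Nat.succ_le_of_lt h)]
      exact x.2 i
    · beta_reduce
      rw [min_eq_right h, min_eq_right (h.trans i.le_succ)]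
      exact adj_self _⟩

theorem continuous_freeze (n : ℕ) : Continuous (freeze n) :=
  Continuous.subtype_mk (continuous_pi fun i => FinGraph.continuous_coord (min i n)) _

theorem tendsto_freeze (x : figureEight.Shift) :
    Tendsto (fun n => freeze n x) atTop (𝓝 x) := by
  rw [tendsto_subtype_rng, tendsto_pi_nhds]
  intro i
  refine tendsto_const_nhds.congr' ?_
  filter_upwards [eventually_ge_atTop i] with n hn
  simp [freeze, min_eq_left hn]

theorem freeze_succ_prepend (n : ℕ) {e : DirEdge 2} {x : figureEight.Shift}
    (h : figureEight.Adj e (x.1 0)) :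
    freeze (n + 1) (figureEight.prepend e x) = figureEight.prepend e (freeze n x) := by
  have h' : figureEight.Adj e ((freeze n x).1 0) := by simpa [freeze] using h
  apply Subtype.ext
  funext i
  cases i with
  | zero => rw [FinGraph.prepend_zero h']; simpa [freeze] using FinGraph.prepend_zero h
  | succ i =>
    rw [FinGraph.prepend_succ h']
    simp only [freeze]
    rw [Nat.succ_min_succ, FinGraph.prepend_succ h]

/-- A preimage has one more edge in front, so each application of the operator lowers the freezing
time by one. -/
theorem transfer_comp_freeze (l : Fin 2 → ℝ) (n : ℕ) (φ : figureEight.Shift → ℝ)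
    (x : figureEight.Shift) :
    figureEight.transfer (fun x => -figureEight.onShift l x) (fun y => φ (freeze (n + 1) y)) x =
      figureEight.transfer (fun x => -figureEight.onShift l x) φ (freeze n x) := by
  classical
  rw [FinGraph.transfer_eq_sum, FinGraph.transfer_eq_sum]
  refine Finset.sum_congr rfl fun e _ => ?_
  have h0 : (freeze n x).1 0 = x.1 0 := by simp [freeze]
  rw [h0]
  split_ifs with h
  · rw [freeze_succ_prepend n h, FinGraph.onShift, FinGraph.onShift, FinGraph.prepend_zero h,
      FinGraph.prepend_zero (by rwa [h0])]
  · rfl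

/-- Freezing at time 0 leaves a function of the initial edge, whose integral is known. Conformality
reduces freezing at time n + 1 to time n, and dominated convergence removes the freezing. -/
theorem IsConformal.unique (hl : ∀ i, 0 < l i) {μ ν : Measure figureEight.Shift}
    (hμ : IsConformal l μ) (hν : IsConformal l ν) : μ = ν := by
  have := hμ.1
  have := hν.1
  have hfreeze (n : ℕ) : ∀ φ : figureEight.Shift → ℝ, Continuous φ →
      ∫ x, φ (freeze n x) ∂μ = ∫ x, φ (freeze n x) ∂ν := by
    induction n with
    | zero =>
      intro φ hφ
      have h0 (x : figureEight.Shift) : φ (freeze 0 x) =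
          (fun e : DirEdge 2 => φ ⟨fun _ => e, fun _ => adj_self e⟩) (x.1 0) := by
        simp [freeze]
      simp only [h0]
      rw [hμ.integral_edgeFun hl (fun e => φ ⟨fun _ => e, fun _ => adj_self e⟩),
        hν.integral_edgeFun hl (fun e => φ ⟨fun _ => e, fun _ => adj_self e⟩)]
    | succ n ih =>
      intro φ hφ
      have hc : Continuous fun x => φ (freeze (n + 1) x) := hφ.comp (continuous_freeze _)
      rw [← hμ.integral_transfer hc, ← hν.integral_transfer hc]
      simp only [transfer_comp_freeze]
      exact ih _ (FinGraph.continuous_transfer (continuous_potential l) hφ)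
  -- A metric serves only to conclude that integrals of continuous functions determine a finite
  -- measure.
  have : TopologicalSpace.MetrizableSpace figureEight.Shift :=
    IsEmbedding.subtypeVal.metrizableSpace
  let := TopologicalSpace.metrizableSpaceMetric figureEight.Shift
  apply ext_of_forall_integral_eq_of_IsFiniteMeasure
  intro φ
  have hlim (ρ : Measure figureEight.Shift) [IsProbabilityMeasure ρ] :
      Tendsto (fun n => ∫ x, φ (freeze n x) ∂ρ) atTop (𝓝 (∫ x, φ x ∂ρ)) := by
    refine tendsto_integral_of_dominated_convergence (fun _ => ‖φ‖) ?_ (integrable_const _) ?_ ?_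
    · exact fun n => (φ.continuous.comp (continuous_freeze n)).aestronglyMeasurable
    · exact fun n => ae_of_all _ fun x => φ.norm_coe_le_norm _
    · exact ae_of_all _ fun x => (φ.continuous.tendsto x).comp (tendsto_freeze x)
  exact tendsto_nhds_unique (hlim μ)
    ((hlim ν).congr fun n => (hfreeze n φ φ.continuous).symm)

/-- A set of paths which contains all extensions of its members to the left is dense. -/
theorem dense_of_prepend_mem {S : Set figureEight.Shift} (hne : S.Nonempty)
    (hS : ∀ x ∈ S, ∀ e, figureEight.Adj e (x.1 0) → figureEight.prepend e x ∈ S) : Dense S := by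
  -- Agreement on the first coordinates is built from right to left. The base case needs a
  -- connecting edge `d`, since `z.1 0` need not be allowed before `x`.
  have key (n : ℕ) : ∀ z : figureEight.Shift, ∃ y ∈ S, ∀ i ≤ n, y.1 i = z.1 i := by
    induction n with
    | zero =>
      intro z
      obtain ⟨x, hx⟩ := hne
      obtain ⟨d, h1, h2⟩ := exists_adj_adj (z.1 0) (x.1 0)
      have h1' : figureEight.Adj (z.1 0) ((figureEight.prepend d x).1 0) := by
        rwa [FinGraph.prepend_zero h2]
      refine ⟨_, hS _ (hS x hx d h2) _ h1', fun i hi => ?_⟩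
      rw [Nat.le_zero.mp hi, FinGraph.prepend_zero h1']
    | succ n ih =>
      intro z
      obtain ⟨y, hy, hyz⟩ := ih (figureEight.shift z)
      have h : figureEight.Adj (z.1 0) (y.1 0) := by
        rw [hyz 0 (Nat.zero_le _)]; exact z.2 0
      refine ⟨_, hS y hy _ h, fun i hi => ?_⟩
      cases i with
      | zero => exact FinGraph.prepend_zero h
      | succ i =>
        rw [FinGraph.prepend_succ h]
        exact hyz i (by omega)
  intro z
  choose y hy hyz using fun n => key n z
  refine mem_closure_of_tendsto (f := y) (b := atTop) ?_ (Eventually.of_forall hy)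
  rw [tendsto_subtype_rng, tendsto_pi_nhds]
  intro i
  refine tendsto_const_nhds.congr' ?_
  filter_upwards [eventually_ge_atTop i] with n hn
  exact (hyz n i hn).symm

/-- The positive eigenfunction for the eigenvalue one is unique up to scaling. -/
theorem eigenfunction_unique (h : Critical l) {v : figureEight.Shift → ℝ} (hv : Continuous v)
    (hpos : ∀ x, 0 < v x)
    (hfix : ∀ x, figureEight.transfer (fun x => -figureEight.onShift l x) v x = v x) :
    ∃ c > 0, ∀ x, v x = c * figureEight.onShift (density l) x := by
  classical
  set w := figureEight.onShift (density l) with hw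
  have hwpos (x) : 0 < w x := density_pos _ _
  have hwc : Continuous w := FinGraph.continuous_onShift _
  have hcont : Continuous fun x => v x / w x := hv.div hwc fun x => (hwpos x).ne'
  let x₁ : figureEight.Shift := ⟨fun _ => (0, true), fun _ => adj_self _⟩
  obtain ⟨x₀, -, hx₀⟩ := isCompact_univ.exists_isMaxOn ⟨x₁, mem_univ _⟩ hcont.continuousOn
  set c := v x₀ / w x₀ with hc
  have hle (x) : v x ≤ c * w x := by
    have : v x / w x ≤ c := hx₀ (mem_univ x)
    rwa [div_le_iff₀ (hwpos x)] at this
  refine ⟨c, div_pos (hpos _) (hwpos _), ?_⟩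
  -- Maximum principle: at a point where v = c w, the eigenvalue equations make two sums of termwise
  -- comparable terms equal, so v = c w at every preimage. Backward orbits are dense.
  have hdense : Dense {x | v x = c * w x} := by
    apply dense_of_prepend_mem ⟨x₀, by simp [hc, div_mul_cancel₀ _ (hwpos x₀).ne']⟩
    intro x hx e he
    have h1 := hfix x
    have h2 := congrArg (c * ·) (transfer_density h x)
    simp only [← hw] at h2
    rw [← FinGraph.transfer_const_mul, ← hx, ← h1, FinGraph.transfer_eq_sum,
      FinGraph.transfer_eq_sum] at h2
    have h3 := (Finset.sum_eq_sum_iff_of_le (fun d _ => ?_)).mp h2.symm e (Finset.mem_univ e)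
    · rw [if_pos he, if_pos he] at h3
      exact mul_left_cancel₀ (Real.exp_pos _).ne' h3
    · split_ifs
      · exact mul_le_mul_of_nonneg_left (hle _) (Real.exp_pos _).le
      · exact le_rfl
  have hclosed : IsClosed {x | v x = c * w x} := isClosed_eq hv (continuous_const.mul hwc)
  intro x
  have := hclosed.closure_eq ▸ hdense x
  exact this

/-- The equilibrium state of `-l`. -/
def gibbs (l : Fin 2 → ℝ) : Measure figureEight.Shift :=
  (conformal l).withDensity fun x => ENNReal.ofReal
    (figureEight.onShift (density l) x / ∫ y, figureEight.onShift (density l) y ∂(conformal l))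

/-- The measure is forced, the eigenfunction is forced up to a factor, and that factor cancels in
the normalization. -/
theorem isEquilibriumState_iff (hl : ∀ i, 0 < l i) (h : Critical l)
    (m : Measure figureEight.Shift) :
    figureEight.IsEquilibriumState (fun x => -figureEight.onShift l x) m ↔ m = gibbs l := by
  constructor
  · rintro ⟨v, μ, hpos, hfix, hprob, hdual, rfl⟩
    rw [IsConformal.unique hl ⟨hprob, hdual⟩ (isConformal_conformal h), gibbs]
    obtain ⟨c, hc, hcv⟩ := eigenfunction_unique h v.continuous hpos hfix
    congr 1
    funext x
    simp only [hcv]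
    rw [integral_const_mul, mul_div_mul_left _ _ hc.ne']
  · rintro rfl
    exact ⟨⟨_, FinGraph.continuous_onShift (density l)⟩, conformal l, fun x => density_pos _ _,
      transfer_density h, isProbabilityMeasure_conformal h, (isConformal_conformal h).2, rfl⟩

theorem eqState_eq (hl : ∀ i, 0 < l i) (h : Critical l) :
    figureEight.eqState l = gibbs l := by
  rw [← isEquilibriumState_iff hl h]
  exact Classical.epsilon_spec ⟨gibbs l, (isEquilibriumState_iff hl h _).2 rfl⟩

end FigureEight

/-! ### Means and asymptotic variances for the equilibrium state -/

namespace FigureEight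

variable {l : Fin 2 → ℝ}

theorem integral_density_pos (h : Critical l) :
    0 < ∫ y, figureEight.onShift (density l) y ∂(conformal l) := by
  have := isProbabilityMeasure_conformal h
  have hc := FinGraph.continuous_onShift (G := figureEight) (density l)
  rw [integral_pos_iff_support_of_nonneg (f := figureEight.onShift (density l))
    (fun x => (density_pos _ _).le) (FinGraph.integrable_of_continuous _ hc)]
  have : Function.support (figureEight.onShift (density l)) = univ := by
    ext x; simp [FinGraph.onShift, (density_pos l _).ne']
  rw [this]
  simp

theorem integral_gibbs (l : Fin 2 → ℝ) (g : figureEight.Shift → ℝ) :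
    ∫ x, g x ∂(gibbs l) = (∫ x, figureEight.onShift (density l) x * g x ∂(conformal l)) /
      ∫ y, figureEight.onShift (density l) y ∂(conformal l) := by
  have hc := FinGraph.continuous_onShift (G := figureEight) (density l)
  rw [gibbs, integral_withDensity_eq_integral_toReal_smul
    ((hc.measurable.div_const _).ennreal_ofReal) (ae_of_all _ fun x => ENNReal.ofReal_lt_top),
    ← integral_div]
  refine integral_congr_ae (ae_of_all _ fun x => ?_)
  simp only [smul_eq_mul]
  rw [ENNReal.toReal_ofReal]
  · ring
  · exact div_nonneg (density_pos _ _).le (integral_nonneg fun x => (density_pos _ _).le)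

theorem isProbabilityMeasure_gibbs (h : Critical l) : IsProbabilityMeasure (gibbs l) := by
  have := isProbabilityMeasure_conformal h
  have hc := FinGraph.continuous_onShift (G := figureEight) (density l)
  have hZ := integral_density_pos h
  constructor
  rw [gibbs, withDensity_apply _ MeasurableSet.univ, Measure.restrict_univ,
    ← ofReal_integral_eq_lintegral_ofReal
      (FinGraph.integrable_of_continuous _ (hc.div_const _))
      (ae_of_all _ fun x => div_nonneg (density_pos _ _).le hZ.le),
    integral_div, div_self hZ.ne', ENNReal.ofReal_one]

/-- With w the eigenfunction, the operator sends w · (g ∘ σ) to w · g, and the conformal measure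
does not see the operator. -/
theorem integral_gibbs_comp_shift (h : Critical l) {g : figureEight.Shift → ℝ}
    (hg : Continuous g) : ∫ x, g (figureEight.shift x) ∂(gibbs l) = ∫ x, g x ∂(gibbs l) := by
  have hc := FinGraph.continuous_onShift (G := figureEight) (density l)
  have hgs : Continuous fun x => figureEight.onShift (density l) x * g (figureEight.shift x) :=
    hc.mul (hg.comp FinGraph.continuous_shift)
  rw [integral_gibbs, integral_gibbs, ← (isConformal_conformal h).integral_transfer hgs]
  congr 2
  funext x
  exact (FinGraph.transfer_mul_comp_shift _ _ g x).trans (by rw [transfer_density h])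

/-- The second eigenvalue of the transition matrix between the two edges. -/
def rate (l : Fin 2 → ℝ) : ℝ := Real.exp (-l 0) + Real.exp (-l 1) - 1

theorem exp_neg_lt_one {i : Fin 2} (hl : ∀ i, 0 < l i) : Real.exp (-l i) < 1 :=
  Real.exp_lt_one_iff.2 (by linarith [hl i])

theorem rate_lt_one (hl : ∀ i, 0 < l i) : rate l < 1 := by
  have h0 := exp_neg_lt_one (i := 0) hl
  have h1 := exp_neg_lt_one (i := 1) hl
  unfold rate; linarith

theorem abs_rate_lt_one (hl : ∀ i, 0 < l i) : |rate l| < 1 := by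
  rw [abs_lt]
  refine ⟨?_, rate_lt_one hl⟩
  have h0 := Real.exp_pos (-l 0)
  have h1 := Real.exp_pos (-l 1)
  unfold rate; linarith

/-- The mean of an edge function with respect to the equilibrium state of `-l`. -/
def mean (l φ : Fin 2 → ℝ) : ℝ :=
  ((1 - Real.exp (-l 1)) * φ 0 + (1 - Real.exp (-l 0)) * φ 1) /
    (2 - Real.exp (-l 0) - Real.exp (-l 1))

/-- The centering condition puts the product of eigenfunction and `φ` into the second eigenspace of
the 2×2 matrix. The weights (1 - Y, 1 - X) are proportional to the stationary law of the undirected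
edges. -/
theorem transfer_density_mul (h : Critical l) {φ : Fin 2 → ℝ}
    (hφ : (1 - Real.exp (-l 1)) * φ 0 + (1 - Real.exp (-l 0)) * φ 1 = 0)
    (x : figureEight.Shift) :
    figureEight.transfer (fun x => -figureEight.onShift l x)
      (fun y => figureEight.onShift (density l) y * figureEight.onShift φ y) x =
      rate l * (figureEight.onShift (density l) x * figureEight.onShift φ x) := by
  refine (transfer_onShift l (fun i => density l i * φ i) x).trans ?_
  simp only [FinGraph.onShift]
  unfold Critical at h
  have h0 := Real.exp_pos (-l 0)
  have h1 := Real.exp_pos (-l 1)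
  generalize (x.1 0).1 = i
  unfold rate density
  fin_cases i
  · simp only [Fin.zero_eta]
    set X := Real.exp (-l 0)
    set Y := Real.exp (-l 1)
    field_simp
    linear_combination (1 + Y) * hφ - φ 1 * h
  · simp only [Fin.mk_one]
    set X := Real.exp (-l 0)
    set Y := Real.exp (-l 1)
    field_simp
    linear_combination (1 + X) * hφ - φ 0 * h

/-- Correlations with a function of mean zero decay by the factor `rate l` in each step. -/
theorem integral_gibbs_mul_comp_shift (h : Critical l) {φ : Fin 2 → ℝ}
    (hφ : (1 - Real.exp (-l 1)) * φ 0 + (1 - Real.exp (-l 0)) * φ 1 = 0)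
    {u : figureEight.Shift → ℝ} (hu : Continuous u) :
    ∫ x, figureEight.onShift φ x * u (figureEight.shift x) ∂(gibbs l) =
      rate l * ∫ x, figureEight.onShift φ x * u x ∂(gibbs l) := by
  have hc := FinGraph.continuous_onShift (G := figureEight) (density l)
  have hc' := FinGraph.continuous_onShift (G := figureEight) φ
  rw [integral_gibbs, integral_gibbs, ← mul_div_assoc, ← integral_const_mul]
  congr 1
  have hcu : Continuous fun x => figureEight.onShift (density l) x * figureEight.onShift φ x *
      u (figureEight.shift x) := (hc.mul hc').mul (hu.comp FinGraph.continuous_shift)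
  simp only [← mul_assoc]
  rw [← (isConformal_conformal h).integral_transfer hcu]
  congr 1
  funext x
  refine (FinGraph.transfer_mul_comp_shift _ _ u x).trans ?_
  rw [transfer_density_mul h hφ]
  ring

/-- Correlation with the constant 1 gives I = r I, and r < 1. -/
theorem integral_onShift_of_centered (hl : ∀ i, 0 < l i) (h : Critical l) {φ : Fin 2 → ℝ}
    (hφ : (1 - Real.exp (-l 1)) * φ 0 + (1 - Real.exp (-l 0)) * φ 1 = 0) :
    ∫ x, figureEight.onShift φ x ∂(gibbs l) = 0 := by
  have := integral_gibbs_mul_comp_shift h hφ (u := fun _ => 1) continuous_const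
  simp only [mul_one] at this
  have h1 := rate_lt_one hl
  have h2 : (1 - rate l) * ∫ x, figureEight.onShift φ x ∂(gibbs l) = 0 := by linarith
  exact (mul_eq_zero.mp h2).resolve_left (by linarith)

theorem centered_sub_mean (hl : ∀ i, 0 < l i) (φ : Fin 2 → ℝ) :
    (1 - Real.exp (-l 1)) * (φ 0 - mean l φ) + (1 - Real.exp (-l 0)) * (φ 1 - mean l φ) = 0 := by
  have h0 := exp_neg_lt_one (i := 0) hl
  have h1 := exp_neg_lt_one (i := 1) hl
  have : 2 - Real.exp (-l 0) - Real.exp (-l 1) ≠ 0 := by linarith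
  unfold mean
  field_simp
  ring

theorem integral_onShift (hl : ∀ i, 0 < l i) (h : Critical l) (φ : Fin 2 → ℝ) :
    ∫ x, figureEight.onShift φ x ∂(gibbs l) = mean l φ := by
  have := isProbabilityMeasure_gibbs h
  have h1 := integral_onShift_of_centered hl h (φ := fun i => φ i - mean l φ)
    (centered_sub_mean hl φ)
  have h2 : ∫ x, figureEight.onShift (fun i => φ i - mean l φ) x ∂(gibbs l) =
      ∫ x, (figureEight.onShift φ x - mean l φ) ∂(gibbs l) := rfl
  rw [h2, integral_sub (FinGraph.integrable_of_continuous _ (FinGraph.continuous_onShift φ))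
    (integrable_const _)] at h1
  simp at h1
  linarith

theorem continuous_birkhoffSum (φ : Fin 2 → ℝ) (n : ℕ) :
    Continuous (birkhoffSum figureEight.shift (figureEight.onShift φ) n) := by
  unfold birkhoffSum
  exact continuous_finsetSum _ fun i _ =>
    (FinGraph.continuous_onShift φ).comp (FinGraph.continuous_shift.iterate i)

/-- The recursion for the correlation of a centered function with its Birkhoff sums. -/
theorem integral_mul_birkhoffSum_succ (h : Critical l) {φ : Fin 2 → ℝ}
    (hφ : (1 - Real.exp (-l 1)) * φ 0 + (1 - Real.exp (-l 0)) * φ 1 = 0) (n : ℕ) :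
    ∫ x, figureEight.onShift φ x *
      birkhoffSum figureEight.shift (figureEight.onShift φ) (n + 1) x ∂(gibbs l) =
      ∫ x, figureEight.onShift φ x ^ 2 ∂(gibbs l) + rate l * ∫ x, figureEight.onShift φ x *
        birkhoffSum figureEight.shift (figureEight.onShift φ) n x ∂(gibbs l) := by
  have := isProbabilityMeasure_gibbs h
  have hc := FinGraph.continuous_onShift (G := figureEight) φ
  have hb := continuous_birkhoffSum φ n
  simp only [birkhoffSum_succ', mul_add]
  rw [integral_add, integral_gibbs_mul_comp_shift h hφ hb]
  · simp only [sq]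
  · exact FinGraph.integrable_of_continuous _ (hc.mul hc)
  · exact FinGraph.integrable_of_continuous _ (hc.mul (hb.comp FinGraph.continuous_shift))

/-- Expand the square of φ + S_n ∘ σ: invariance handles the square of S_n ∘ σ, and the cross term
picks up one factor `rate l`. -/
theorem integral_birkhoffSum_sq_succ (h : Critical l) {φ : Fin 2 → ℝ}
    (hφ : (1 - Real.exp (-l 1)) * φ 0 + (1 - Real.exp (-l 0)) * φ 1 = 0) (n : ℕ) :
    ∫ x, birkhoffSum figureEight.shift (figureEight.onShift φ) (n + 1) x ^ 2 ∂(gibbs l) =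
      ∫ x, birkhoffSum figureEight.shift (figureEight.onShift φ) n x ^ 2 ∂(gibbs l) +
      (∫ x, figureEight.onShift φ x ^ 2 ∂(gibbs l) + 2 * rate l * ∫ x, figureEight.onShift φ x *
        birkhoffSum figureEight.shift (figureEight.onShift φ) n x ∂(gibbs l)) := by
  have := isProbabilityMeasure_gibbs h
  have hc := FinGraph.continuous_onShift (G := figureEight) φ
  have hb := continuous_birkhoffSum φ n
  have hbs := hb.comp FinGraph.continuous_shift
  have h1 (x) : birkhoffSum figureEight.shift (figureEight.onShift φ) (n + 1) x ^ 2 =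
      birkhoffSum figureEight.shift (figureEight.onShift φ) n (figureEight.shift x) ^ 2 +
      (figureEight.onShift φ x ^ 2 + 2 * (figureEight.onShift φ x *
        birkhoffSum figureEight.shift (figureEight.onShift φ) n (figureEight.shift x))) := by
    rw [birkhoffSum_succ']; ring
  simp only [h1]
  have hsq : Continuous fun x =>
    birkhoffSum figureEight.shift (figureEight.onShift φ) n x ^ 2 := hb.pow 2
  rw [integral_add, integral_add, integral_const_mul, integral_gibbs_mul_comp_shift h hφ hb,
    integral_gibbs_comp_shift h hsq]
  · ring
  · exact FinGraph.integrable_of_continuous _ (hc.pow 2)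
  · exact FinGraph.integrable_of_continuous _ (continuous_const.mul (hc.mul hbs))
  · exact FinGraph.integrable_of_continuous _ (hbs.pow 2)
  · exact FinGraph.integrable_of_continuous _ ((hc.pow 2).add (continuous_const.mul (hc.mul hbs)))

/-- The correlations a_n of φ with S_n satisfy a_{n+1} = V + r a_n, hence are partial geometric
sums. The increments V + 2 r a_n of the second moments converge, and Cesàro averaging gives the
limit V + 2 r V/(1 - r). -/
theorem tendsto_integral_birkhoffSum_sq (hl : ∀ i, 0 < l i) (h : Critical l) {φ : Fin 2 → ℝ}
    (hφ : (1 - Real.exp (-l 1)) * φ 0 + (1 - Real.exp (-l 0)) * φ 1 = 0) :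
    Tendsto (fun n : ℕ => (n : ℝ)⁻¹ *
      ∫ x, birkhoffSum figureEight.shift (figureEight.onShift φ) n x ^ 2 ∂(gibbs l)) atTop
      (𝓝 ((1 + rate l) / (1 - rate l) * ∫ x, figureEight.onShift φ x ^ 2 ∂(gibbs l))) := by
  set V := ∫ x, figureEight.onShift φ x ^ 2 ∂(gibbs l) with hV
  have hr : 1 - rate l ≠ 0 := by linarith [rate_lt_one hl]
  have hcorr (n : ℕ) : ∫ x, figureEight.onShift φ x *
      birkhoffSum figureEight.shift (figureEight.onShift φ) n x ∂(gibbs l) =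
      V * (1 - rate l ^ n) / (1 - rate l) := by
    induction n with
    | zero => simp
    | succ n ih =>
      rw [integral_mul_birkhoffSum_succ h hφ, ih, ← hV]
      field_simp
      ring
  have hsum (n : ℕ) :
      ∫ x, birkhoffSum figureEight.shift (figureEight.onShift φ) n x ^ 2 ∂(gibbs l) =
      ∑ i ∈ Finset.range n, (V + 2 * rate l * (V * (1 - rate l ^ i) / (1 - rate l))) := by
    induction n with
    | zero => simp
    | succ n ih => rw [integral_birkhoffSum_sq_succ h hφ, ih, hcorr, Finset.sum_range_succ]
  simp only [hsum]
  have hlim : Tendsto (fun i : ℕ => V + 2 * rate l * (V * (1 - rate l ^ i) / (1 - rate l))) atTop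
      (𝓝 (V + 2 * rate l * (V * (1 - 0) / (1 - rate l)))) := by
    have := tendsto_pow_atTop_nhds_zero_of_abs_lt_one (abs_rate_lt_one hl)
    exact (((((this.const_sub 1).const_mul V).div_const _).const_mul _).const_add V)
  have heq : (1 + rate l) / (1 - rate l) * V = V + 2 * rate l * (V * (1 - 0) / (1 - rate l)) := by
    field_simp
    ring
  rw [heq]
  exact hlim.cesaro

/-- The asymptotic variance of an edge function. -/
def variance (l φ : Fin 2 → ℝ) : ℝ :=
  (1 - Real.exp (-l 0)) * (1 - Real.exp (-l 1)) * (Real.exp (-l 0) + Real.exp (-l 1)) *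
    (φ 0 - φ 1) ^ 2 / (2 - Real.exp (-l 0) - Real.exp (-l 1)) ^ 3

theorem tendsto_varSeq (hl : ∀ i, 0 < l i) (h : Critical l) (φ : Fin 2 → ℝ) :
    Tendsto (figureEight.varSeq (figureEight.onShift φ) (figureEight.eqState l)) atTop
      (𝓝 (variance l φ)) := by
  have h1 := tendsto_integral_birkhoffSum_sq hl h (φ := fun i => φ i - mean l φ)
    (centered_sub_mean hl φ)
  have h2 : ∫ x, figureEight.onShift (fun i => φ i - mean l φ) x ^ 2 ∂(gibbs l) =
      mean l (fun i => (φ i - mean l φ) ^ 2) :=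
    integral_onShift hl h (fun i => (φ i - mean l φ) ^ 2)
  have h3 : (1 + rate l) / (1 - rate l) * mean l (fun i => (φ i - mean l φ) ^ 2) =
      variance l φ := by
    have h0 := exp_neg_lt_one (i := 0) hl
    have h1 := exp_neg_lt_one (i := 1) hl
    have hd : 2 - Real.exp (-l 0) - Real.exp (-l 1) ≠ 0 := by linarith
    have hd' : 1 - rate l = 2 - Real.exp (-l 0) - Real.exp (-l 1) := by unfold rate; ring
    rw [hd', rate]
    unfold mean variance
    field_simp
    ring
  rw [h2, h3] at h1
  refine h1.congr fun n => ?_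
  rw [FinGraph.varSeq, eqState_eq hl h, integral_onShift hl h, one_div]
  congr 2
  funext x
  simp only [birkhoffSum, FinGraph.onShift, Finset.sum_sub_distrib, Finset.sum_const,
    Finset.card_range, nsmul_eq_mul]

theorem asympVar_eq (hl : ∀ i, 0 < l i) (h : Critical l) (φ : Fin 2 → ℝ) :
    figureEight.asympVar (figureEight.onShift φ) (figureEight.eqState l) = variance l φ :=
  (tendsto_varSeq hl h φ).limUnder_eq

theorem mean_self_pos (hl : ∀ i, 0 < l i) : 0 < mean l l := by
  have h0 := exp_neg_lt_one (i := 0) hl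
  have h1 := exp_neg_lt_one (i := 1) hl
  have hp0 := hl 0
  have hp1 := hl 1
  refine div_pos ?_ (by linarith)
  exact add_pos (mul_pos (by linarith) hp0) (mul_pos (by linarith) hp1)

theorem wpNormSq_eq (hl : ∀ i, 0 < l i) (h : Critical l) (φ : Fin 2 → ℝ) :
    figureEight.wpNormSq l φ = variance l φ / mean l l := by
  rw [FinGraph.wpNormSq, asympVar_eq hl h, eqState_eq hl h, integral_onShift hl h]

end FigureEight

/-! ### Counting closed cycles: entropy one is criticality -/

namespace FigureEight

variable {l : Fin 2 → ℝ}

/-- The length of the walk `e :: p`, without its last edge. -/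
def walkLength (l : Fin 2 → ℝ) : DirEdge 2 → List (DirEdge 2) → ℝ
  | _, [] => 0
  | e, d :: p => l e.1 + walkLength l d p

theorem walkLength_nonneg (hl : ∀ i, 0 < l i) (e : DirEdge 2) (p : List (DirEdge 2)) :
    0 ≤ walkLength l e p := by
  induction p generalizing e with
  | nil => exact le_rfl
  | cons d p ih => exact add_nonneg (hl _).le (ih d)

/-- The continuations of `e` to a walk of length less than `T`. -/
def walks (l : Fin 2 → ℝ) (e : DirEdge 2) (T : ℝ) : Set (List (DirEdge 2)) :=
  {p | List.IsChain figureEight.Adj (e :: p) ∧ walkLength l e p < T}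

theorem walks_of_nonpos (hl : ∀ i, 0 < l i) (e : DirEdge 2) {T : ℝ} (hT : T ≤ 0) :
    walks l e T = ∅ := by
  ext p
  simp only [walks, mem_ofPred_eq, mem_empty_iff_false, iff_false, not_and, not_lt]
  exact fun _ => hT.trans (walkLength_nonneg hl e p)

/-- A walk is trivial or consists of a first step and a walk from the next edge. -/
def walksEquiv (l : Fin 2 → ℝ) (e : DirEdge 2) {T : ℝ} (hT : 0 < T) :
    Option (Σ d : {d // figureEight.Adj e d}, walks l d.1 (T - l e.1)) ≃ walks l e T where
  toFun
    | none => ⟨[], List.isChain_singleton e, hT⟩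
    | some ⟨d, p⟩ => ⟨d.1 :: p.1, List.isChain_cons_cons.2 ⟨d.2, p.2.1⟩, by
        have := p.2.2
        show l e.1 + walkLength l d.1 p.1 < T
        linarith⟩
  invFun
    | ⟨[], _⟩ => none
    | ⟨d :: p, hp⟩ => some ⟨⟨d, (List.isChain_cons_cons.1 hp.1).1⟩,
        ⟨p, (List.isChain_cons_cons.1 hp.1).2, by
          have : l e.1 + walkLength l d p < T := hp.2
          show walkLength l d p < T - l e.1
          linarith⟩⟩
  left_inv x := by rcases x with _ | ⟨d, p⟩ <;> rfl
  right_inv x := by rcases x with ⟨_ | ⟨d, p⟩, hp⟩ <;> rfl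

/-- Induction on the length bound of a walk. -/
theorem walk_induction (hl : ∀ i, 0 < l i) {P : DirEdge 2 → ℝ → Prop}
    (h0 : ∀ e T, T ≤ 0 → P e T)
    (h1 : ∀ e T, 0 < T → (∀ d, P d (T - l e.1)) → P e T) (e : DirEdge 2) (T : ℝ) : P e T := by
  -- Every step of a walk uses up at least the shorter edge length, so induction on multiples of it
  -- reaches every T.
  obtain ⟨δ, hδ, hδl⟩ : ∃ δ > 0, ∀ i, δ ≤ l i :=
    ⟨min (l 0) (l 1), lt_min (hl 0) (hl 1), fun i => by fin_cases i <;> simp⟩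
  have key (n : ℕ) : ∀ e T, T ≤ n * δ → P e T := by
    induction n with
    | zero => exact fun e T hT => h0 e T (by simpa using hT)
    | succ n ih =>
      intro e T hT
      rcases le_or_gt T 0 with hT0 | hT0
      · exact h0 e T hT0
      · refine h1 e T hT0 fun d => ih d _ ?_
        have := hδl e.1
        push_cast at hT
        linarith
  obtain ⟨n, hn⟩ := exists_nat_ge (T / δ)
  exact key n e T (by rwa [div_le_iff₀ hδ] at hn)

theorem finite_walks (hl : ∀ i, 0 < l i) (e : DirEdge 2) (T : ℝ) : (walks l e T).Finite := by
  refine walk_induction hl (P := fun e T => (walks l e T).Finite) ?_ ?_ e T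
  · intro e T hT
    rw [walks_of_nonpos hl e hT]
    exact finite_empty
  · intro e T hT ih
    have (d : {d // figureEight.Adj e d}) : Finite (walks l d.1 (T - l e.1)) := ih d.1
    have : Finite (walks l e T) := Finite.of_equiv _ (walksEquiv l e hT)
    exact toFinite _

open Classical in
theorem ncard_walks (hl : ∀ i, 0 < l i) (e : DirEdge 2) {T : ℝ} (hT : 0 < T) :
    ((walks l e T).ncard : ℝ) = 1 +
      ∑ d, if figureEight.Adj e d then ((walks l d (T - l e.1)).ncard : ℝ) else 0 := by
  have (d : {d // figureEight.Adj e d}) : Finite (walks l d.1 (T - l e.1)) := finite_walks hl _ _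
  rw [← Nat.card_coe_set_eq, ← Nat.card_congr (walksEquiv l e hT), Finite.card_option,
    Nat.card_sigma]
  push_cast
  rw [add_comm, ← Finset.sum_filter, ← Finset.sum_subtype_eq_sum_filter]
  congr 1
  refine Finset.sum_bij (fun e _ => ⟨e.1, e.2⟩) ?_ ?_ ?_ ?_ <;> simp

theorem edgeMass_lt_one (l : Fin 2 → ℝ) (e : DirEdge 2) : edgeMass l e < 1 := by
  unfold edgeMass
  have := Real.exp_pos (-l e.1)
  rw [div_lt_one (by positivity)]
  linarith

open Classical in
-- This makes `edgeMass l e * exp T` a solution of the renewal equation of `ncard_walks` without its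
-- constant term 1.
theorem sum_adj_edgeMass (h : Critical l) (e : DirEdge 2) :
    ∑ d, (if figureEight.Adj e d then edgeMass l d else 0) = Real.exp (l e.1) * edgeMass l e := by
  rw [sum_adj_eq, h.sum_edgeMass, edgeMass_bar, edgeMass, Real.exp_neg]
  have := Real.exp_pos (l e.1)
  field_simp
  ring

theorem le_total_length (hl : ∀ i, 0 < l i) (i : Fin 2) : l i ≤ l 0 + l 1 := by
  have h0 := hl 0
  have h1 := hl 1
  fin_cases i <;> simp <;> linarith

/-- The homogeneous solution is a subsolution of the renewal equation. Its constant keeps it at most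
1 when T ≤ l e, where the trivial walk alone suffices. -/
theorem le_ncard_walks (hl : ∀ i, 0 < l i) (h : Critical l) (e : DirEdge 2) {T : ℝ} (hT : 0 < T) :
    Real.exp (-(l 0 + l 1)) * (edgeMass l e * Real.exp T) ≤ (walks l e T).ncard := by
  classical
  revert hT
  refine walk_induction hl (P := fun e T => 0 < T →
    Real.exp (-(l 0 + l 1)) * (edgeMass l e * Real.exp T) ≤ (walks l e T).ncard)
    (fun e T hT hT' => absurd hT' hT.not_gt) ?_ e T
  intro e T hT ih _
  rw [ncard_walks hl e hT]
  rcases le_or_gt (T - l e.1) 0 with h0 | h0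
  · have h1 : Real.exp (-(l 0 + l 1)) * (edgeMass l e * Real.exp T) ≤ 1 := by
      have h2 := edgeMass_lt_one l e
      have h3 := le_total_length hl e.1
      calc Real.exp (-(l 0 + l 1)) * (edgeMass l e * Real.exp T)
          ≤ Real.exp (-(l 0 + l 1)) * (1 * Real.exp T) := by gcongr
        _ = Real.exp (T - (l 0 + l 1)) := by
          rw [one_mul, ← Real.exp_add]; ring_nf
        _ ≤ 1 := Real.exp_le_one_iff.2 (by linarith)
    have h2 : 0 ≤ ∑ d, if figureEight.Adj e d then ((walks l d (T - l e.1)).ncard : ℝ) else 0 :=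
      Finset.sum_nonneg fun d _ => by split_ifs <;> positivity
    linarith
  · have h1 : ∑ d, (if figureEight.Adj e d then Real.exp (-(l 0 + l 1)) *
        (edgeMass l d * Real.exp (T - l e.1)) else 0) ≤
        ∑ d, if figureEight.Adj e d then ((walks l d (T - l e.1)).ncard : ℝ) else 0 := by
      refine Finset.sum_le_sum fun d _ => ?_
      split_ifs
      · exact ih d h0
      · exact le_rfl
    have h2 : ∑ d, (if figureEight.Adj e d then Real.exp (-(l 0 + l 1)) *
        (edgeMass l d * Real.exp (T - l e.1)) else 0) =
        Real.exp (-(l 0 + l 1)) * (edgeMass l e * Real.exp T) := by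
      have h3 (d) : (if figureEight.Adj e d then Real.exp (-(l 0 + l 1)) *
          (edgeMass l d * Real.exp (T - l e.1)) else 0) = (Real.exp (-(l 0 + l 1)) *
          Real.exp (T - l e.1)) * (if figureEight.Adj e d then edgeMass l d else 0) := by
        split_ifs <;> ring
      simp only [h3]
      rw [← Finset.mul_sum, sum_adj_edgeMass h, Real.exp_sub]
      field_simp
    linarith

theorem ncard_walks_le (hl : ∀ i, 0 < l i) (h : Critical l) (e : DirEdge 2) {T : ℝ} (hT : 0 < T) :
    (walks l e T).ncard ≤
      (Real.exp (l 0 + l 1) * ∑ d, (edgeMass l d)⁻¹) * (edgeMass l e * Real.exp T) := by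
  classical
  set C := Real.exp (l 0 + l 1) * ∑ d, (edgeMass l d)⁻¹ with hC
  have hsum (e) : 1 ≤ (∑ d, (edgeMass l d)⁻¹) * edgeMass l e := by
    have := Finset.single_le_sum (f := fun d => (edgeMass l d)⁻¹)
      (fun d _ => (inv_pos.2 (edgeMass_pos l d)).le) (Finset.mem_univ e)
    calc 1 = (edgeMass l e)⁻¹ * edgeMass l e := (inv_mul_cancel₀ (edgeMass_pos l e).ne').symm
      _ ≤ _ := mul_le_mul_of_nonneg_right this (edgeMass_pos l e).le
  -- The extra 1/2 absorbs the constant 1 of the renewal equation: each edge has three successors,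
  -- and 3/2 = 1 + 1/2. The range reaches down to -(l 0 + l 1) so that one step from T > 0 stays
  -- inside it.
  have key : ∀ e T, -(l 0 + l 1) < T →
      ((walks l e T).ncard : ℝ) + 1 / 2 ≤ C * (edgeMass l e * Real.exp T) := by
    refine walk_induction hl ?_ ?_
    · intro e T hT hT'
      rw [walks_of_nonpos hl e hT]
      have h1 : 1 ≤ Real.exp (l 0 + l 1) * Real.exp T := by
        rw [← Real.exp_add]
        exact Real.one_le_exp (by linarith)
      have h2 := one_le_mul_of_one_le_of_one_le h1 (hsum e)
      simp only [ncard_empty, Nat.cast_zero, hC]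
      calc (0 : ℝ) + 1 / 2 ≤ 1 := by norm_num
        _ ≤ _ := h2
        _ = _ := by ring
    · intro e T hT ih _
      have hlt : -(l 0 + l 1) < T - l e.1 := by linarith [le_total_length hl e.1]
      have h1 : ∑ d, (if figureEight.Adj e d then ((walks l d (T - l e.1)).ncard : ℝ) + 1 / 2
          else 0) ≤ ∑ d, (if figureEight.Adj e d then
            C * (edgeMass l d * Real.exp (T - l e.1)) else 0) := by
        refine Finset.sum_le_sum fun d _ => ?_
        split_ifs
        · exact ih d hlt
        · exact le_rfl
      have h2 : ∑ d, (if figureEight.Adj e d then C * (edgeMass l d * Real.exp (T - l e.1)) else 0)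
          = C * (edgeMass l e * Real.exp T) := by
        have h3 (d) : (if figureEight.Adj e d then C * (edgeMass l d * Real.exp (T - l e.1)) else 0)
            = (C * Real.exp (T - l e.1)) * (if figureEight.Adj e d then edgeMass l d else 0) := by
          split_ifs <;> ring
        simp only [h3]
        rw [← Finset.mul_sum, sum_adj_edgeMass h, Real.exp_sub]
        field_simp
      have h3 : ∑ d, (if figureEight.Adj e d then ((walks l d (T - l e.1)).ncard : ℝ) + 1 / 2
          else 0) = (∑ d, if figureEight.Adj e d then ((walks l d (T - l e.1)).ncard : ℝ) else 0) +
            ∑ d, if figureEight.Adj e d then (1 / 2 : ℝ) else 0 := by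
        rw [← Finset.sum_add_distrib]
        refine Finset.sum_congr rfl fun d _ => ?_
        split_ifs <;> ring
      have h4 : ∑ d, (if figureEight.Adj e d then (1 / 2 : ℝ) else 0) = 3 / 2 := by
        rw [sum_adj_eq]
        norm_num
      rw [ncard_walks hl e hT]
      linarith
  have h0 := hl 0
  have h1 := hl 1
  linarith [key e T (by linarith)]

theorem walkLength_ofFn (l : Fin 2 → ℝ) {n : ℕ} (f : Fin (n + 1) → DirEdge 2) :
    walkLength l (f 0) (List.ofFn fun i : Fin n => f i.succ) =
      ∑ i : Fin n, l (f i.castSucc).1 := by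
  induction n with
  | zero => simp [walkLength]
  | succ n ih =>
    rw [List.ofFn_succ, Fin.sum_univ_succ]
    exact congrArg (l (f 0).1 + ·) (ih fun i => f i.succ)

/-- The walk of a closed cycle. -/
def cycleWalk (γ : figureEight.ClosedCycle) : List (DirEdge 2) :=
  List.ofFn fun i : Fin γ.n => γ.edge i.succ

theorem cons_cycleWalk (γ : figureEight.ClosedCycle) :
    γ.edge 0 :: cycleWalk γ = List.ofFn γ.edge := List.ofFn_succ.symm

theorem cycleWalk_mem (γ : figureEight.ClosedCycle) {T : ℝ} (h : γ.length l < T) :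
    cycleWalk γ ∈ walks l (γ.edge 0) T := by
  refine ⟨?_, (walkLength_ofFn l γ.edge).trans_lt h⟩
  rw [cons_cycleWalk, List.isChain_ofFn]
  intro i hi
  exact γ.step ⟨i, by omega⟩

theorem closedCycle_ext {γ γ' : figureEight.ClosedCycle}
    (h : List.ofFn γ.edge = List.ofFn γ'.edge) : γ = γ' := by
  obtain ⟨n, pos, f, hc, hs⟩ := γ
  obtain ⟨n', pos', f', hc', hs'⟩ := γ'
  have hn : n = n' := by simpa using congrArg List.length h
  subst hn
  obtain rfl : f = f' := List.ofFn_injective h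
  rfl

theorem cycles_subset (l : Fin 2 → ℝ) (T : ℝ) :
    MapsTo (fun γ : figureEight.ClosedCycle => List.ofFn γ.edge)
      {γ : figureEight.ClosedCycle | γ.length l < T}
      (⋃ e ∈ (Finset.univ : Finset (DirEdge 2)), List.cons e '' walks l e T) := by
  intro γ hγ
  simp only [Finset.mem_univ, iUnion_true, mem_iUnion]
  exact ⟨γ.edge 0, cycleWalk γ, cycleWalk_mem γ hγ, cons_cycleWalk γ⟩

theorem finite_biUnion_walks (hl : ∀ i, 0 < l i) (T : ℝ) :
    (⋃ e ∈ (Finset.univ : Finset (DirEdge 2)), List.cons e '' walks l e T).Finite :=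
  (Finset.univ.finite_toSet).biUnion fun e _ => (finite_walks hl e T).image _

theorem finite_cycles (hl : ∀ i, 0 < l i) (T : ℝ) :
    {γ : figureEight.ClosedCycle | γ.length l < T}.Finite :=
  Finite.of_injOn (cycles_subset l T) (fun _ _ _ _ h => closedCycle_ext h)
    (finite_biUnion_walks hl T)

theorem ncard_cycles_le (hl : ∀ i, 0 < l i) (T : ℝ) :
    {γ : figureEight.ClosedCycle | γ.length l < T}.ncard ≤ ∑ e, (walks l e T).ncard := by
  refine (ncard_le_ncard_of_injOn _ (cycles_subset l T) (fun _ _ _ _ h => closedCycle_ext h)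
    (finite_biUnion_walks hl T)).trans ?_
  refine (Finset.set_ncard_biUnion_le _ _).trans (Finset.sum_le_sum fun e _ => ?_)
  exact ncard_image_le (finite_walks hl e T)

/-- A closed walk as a closed cycle. -/
def cycleOfWalk (e : DirEdge 2) (q : List (DirEdge 2)) (hq : 0 < q.length)
    (hchain : List.IsChain figureEight.Adj (e :: q)) (hlast : (e :: q).getLast (by simp) = e) :
    figureEight.ClosedCycle where
  n := q.length
  pos := hq
  edge := (e :: q).get
  closed := by
    rw [List.getLast_eq_getElem] at hlast
    exact hlast
  step i := List.isChain_iff_getElem.1 hchain i.1 (by simp)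

theorem length_cycleOfWalk (l : Fin 2 → ℝ) (e : DirEdge 2) (q : List (DirEdge 2))
    (hq : 0 < q.length) (hchain : List.IsChain figureEight.Adj (e :: q))
    (hlast : (e :: q).getLast (by simp) = e) :
    (cycleOfWalk e q hq hchain hlast).length l = walkLength l e q := by
  refine (walkLength_ofFn l (e :: q).get).symm.trans ?_
  congr 1
  exact List.ofFn_get q

theorem ofFn_cycleOfWalk (e : DirEdge 2) (q : List (DirEdge 2))
    (hq : 0 < q.length) (hchain : List.IsChain figureEight.Adj (e :: q))
    (hlast : (e :: q).getLast (by simp) = e) :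
    List.ofFn (cycleOfWalk e q hq hchain hlast).edge = e :: q := List.ofFn_get (e :: q)

/-- Every walk closes up after two more steps. -/
theorem exists_closing (e a : DirEdge 2) (p : List (DirEdge 2))
    (hp : List.IsChain figureEight.Adj (a :: p)) :
    ∃ d, List.IsChain figureEight.Adj (a :: (p ++ [d, e])) ∧
      ∀ l : Fin 2 → ℝ, (∀ i, 0 < l i) →
        walkLength l a (p ++ [d, e]) ≤ walkLength l a p + 2 * (l 0 + l 1) := by
  induction p generalizing a with
  | nil =>
    obtain ⟨d, h1, h2⟩ := exists_adj_adj a e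
    refine ⟨d, by simp [h1, h2], fun l hl => ?_⟩
    have h3 := le_total_length hl a.1
    have h4 := le_total_length hl d.1
    simp only [List.nil_append, walkLength]
    linarith
  | cons b p ih =>
    obtain ⟨hab, hp⟩ := List.isChain_cons_cons.1 hp
    obtain ⟨d, h1, h2⟩ := ih b hp
    refine ⟨d, List.isChain_cons_cons.2 ⟨hab, h1⟩, fun l hl => ?_⟩
    have := h2 l hl
    simp only [List.cons_append, walkLength]
    linarith

/-- Closing a walk with two more edges is injective, since deleting them recovers the walk. As the
last edge is not counted, the cost is the old last edge and one new edge, at most 2(l 0 + l 1). -/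
theorem ncard_walks_le_ncard_cycles (hl : ∀ i, 0 < l i) (e : DirEdge 2) (T : ℝ) :
    (walks l e (T - 2 * (l 0 + l 1))).ncard ≤
      {γ : figureEight.ClosedCycle | γ.length l < T}.ncard := by
  classical
  choose d hd hlen using fun p : {p // List.IsChain figureEight.Adj (e :: p)} =>
    exists_closing e e p.1 p.2
  let f : walks l e (T - 2 * (l 0 + l 1)) → figureEight.ClosedCycle := fun p =>
    cycleOfWalk e (p.1 ++ [d ⟨p.1, p.2.1⟩, e]) (by simp) (hd ⟨p.1, p.2.1⟩) (by simp)
  have hmem (p) : f p ∈ {γ : figureEight.ClosedCycle | γ.length l < T} := by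
    have h1 := hlen ⟨p.1, p.2.1⟩ l hl
    have h2 : walkLength l e p.1 < T - 2 * (l 0 + l 1) := p.2.2
    show (f p).length l < T
    rw [length_cycleOfWalk]
    simp only at h1
    linarith
  have hinj : Function.Injective f := by
    intro p p' h
    have := congrArg (fun γ : figureEight.ClosedCycle => List.ofFn γ.edge) h
    simp only [f, ofFn_cycleOfWalk, List.cons.injEq, true_and] at this
    exact Subtype.ext (List.append_inj_left' this rfl)
  have := finite_cycles hl T
  have : Finite {γ : figureEight.ClosedCycle | γ.length l < T} := this
  rw [← Nat.card_coe_set_eq, ← Nat.card_coe_set_eq]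
  exact Nat.card_le_card_of_injective (fun p => ⟨f p, hmem p⟩)
    fun p p' h => hinj (congrArg Subtype.val h)

theorem hasEntropy_one (hl : ∀ i, 0 < l i) (h : Critical l) : figureEight.HasEntropy l 1 := by
  set L := l 0 + l 1 with hL
  have hL0 : 0 < L := add_pos (hl 0) (hl 1)
  set N : ℝ → ℝ := fun T => ({γ : figureEight.ClosedCycle | γ.length l < T}.ncard : ℕ) with hN
  obtain ⟨c, hc, hlow⟩ : ∃ c > 0, ∀ T > 2 * L, c * Real.exp T ≤ N T := by
    -- The last factor pays for the loss of 2L in closing up walks.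
    refine ⟨Real.exp (-L) * edgeMass l (0, true) * Real.exp (-(2 * L)), ?_, fun T hT => ?_⟩
    · have := edgeMass_pos l (0, true)
      positivity
    · have h1 := le_ncard_walks hl h (0, true) (T := T - 2 * L) (by linarith)
      have h2 : ((walks l (0, true) (T - 2 * L)).ncard : ℝ) ≤ N T :=
        Nat.cast_le.2 (ncard_walks_le_ncard_cycles hl (0, true) T)
      rw [sub_eq_add_neg T, Real.exp_add] at h1
      rw [sub_eq_add_neg T] at h2
      linarith
  obtain ⟨C, hC, hup⟩ : ∃ C > 0, ∀ T > 0, N T ≤ C * Real.exp T := by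
    refine ⟨(Real.exp L * ∑ d, (edgeMass l d)⁻¹) * ∑ e, edgeMass l e, ?_, fun T hT => ?_⟩
    · have : 0 < ∑ d, (edgeMass l d)⁻¹ :=
        Finset.sum_pos (fun d _ => inv_pos.2 (edgeMass_pos l d)) Finset.univ_nonempty
      rw [h.sum_edgeMass]
      positivity
    · have h1 : N T ≤ ∑ e, ((walks l e T).ncard : ℝ) := by
        have := ncard_cycles_le hl T
        simp only [hN]
        exact_mod_cast this
      refine h1.trans ?_
      rw [mul_assoc, Finset.sum_mul, Finset.mul_sum]
      exact Finset.sum_le_sum fun e _ => ncard_walks_le hl h e hT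
  have hlim (a : ℝ) : Tendsto (fun T : ℝ => 1 / T * (Real.log a + T)) atTop (𝓝 1) := by
    have h1 : Tendsto (fun T : ℝ => Real.log a / T + 1) atTop (𝓝 (0 + 1)) :=
      (tendsto_const_nhds.div_atTop tendsto_id).add_const 1
    rw [zero_add] at h1
    refine h1.congr' ?_
    filter_upwards [eventually_gt_atTop 0] with T hT
    field_simp
  refine tendsto_of_tendsto_of_tendsto_of_le_of_le' (hlim c) (hlim C) ?_ ?_
  · filter_upwards [eventually_gt_atTop (2 * L)] with T hT
    have hT0 : 0 < T := by linarith
    refine mul_le_mul_of_nonneg_left ?_ (by positivity)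
    have := Real.log_le_log (by positivity) (hlow T hT)
    rwa [Real.log_mul hc.ne' (Real.exp_pos T).ne', Real.log_exp] at this
  · filter_upwards [eventually_gt_atTop (2 * L)] with T hT
    have hT0 : 0 < T := by linarith
    refine mul_le_mul_of_nonneg_left ?_ (by positivity)
    have hpos : 0 < N T := lt_of_lt_of_le (by positivity) (hlow T hT)
    have := Real.log_le_log hpos (hup T hT0)
    rwa [Real.log_mul hC.ne' (Real.exp_pos T).ne', Real.log_exp] at this

theorem hasEntropy_of_smul {s : ℝ} (hs : 0 < s)
    (h : figureEight.HasEntropy (fun i => s * l i) 1) : figureEight.HasEntropy l s := by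
  have h1 := (h.comp (tendsto_id.const_mul_atTop hs)).const_mul s
  rw [mul_one] at h1
  refine h1.congr fun T => ?_
  have hset : {γ : figureEight.ClosedCycle | γ.length (fun i => s * l i) < s * T} =
      {γ : figureEight.ClosedCycle | γ.length l < T} := by
    ext γ
    simp only [FinGraph.ClosedCycle.length, mem_ofPred_eq, ← Finset.mul_sum]
    exact mul_lt_mul_iff_right₀ hs
  simp only [Function.comp_apply, id_eq, hset]
  rw [← mul_assoc]
  congr 1
  field_simp

/-- Intermediate values along the ray: the critical expression is -4 at s = 0 and tends to 1 as s
grows. -/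
theorem exists_critical_smul (hl : ∀ i, 0 < l i) : ∃ s > 0, Critical (fun i => s * l i) := by
  set F : ℝ → ℝ := fun s => 1 - Real.exp (-(s * l 0)) - Real.exp (-(s * l 1)) -
    3 * Real.exp (-(s * l 0)) * Real.exp (-(s * l 1)) with hF
  have hcont : Continuous F := by fun_prop
  have hlim : Tendsto F atTop (𝓝 (1 - 0 - 0 - 3 * 0 * 0)) := by
    have h (i) : Tendsto (fun s : ℝ => Real.exp (-(s * l i))) atTop (𝓝 0) :=
      Real.tendsto_exp_neg_atTop_nhds_zero.comp (tendsto_id.atTop_mul_const (hl i))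
    exact ((tendsto_const_nhds.sub (h 0)).sub (h 1)).sub (((h 0).const_mul 3).mul (h 1))
  obtain ⟨s, hs0, hs⟩ : ∃ s > 0, 0 < F s :=
    ((eventually_gt_atTop 0).and (hlim.eventually (lt_mem_nhds (by norm_num)))).exists
  have hF0 : F 0 < 0 := by simp [hF]; norm_num
  obtain ⟨t, ht, ht0⟩ := intermediate_value_Ioo hs0.le hcont.continuousOn ⟨hF0, hs⟩
  exact ⟨t, ht.1, ht0⟩

/-- For the direct implication, take s with s l critical. Then l has entropy s by scaling, and
uniqueness of limits gives s = 1. -/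
theorem mem_entropyOne_iff : l ∈ figureEight.entropyOne ↔ (∀ i, 0 < l i) ∧ Critical l := by
  constructor
  · rintro ⟨hl, hent⟩
    refine ⟨hl, ?_⟩
    obtain ⟨s, hs, hcrit⟩ := exists_critical_smul hl
    have h1 := hasEntropy_of_smul hs (hasEntropy_one (fun i => mul_pos hs (hl i)) hcrit)
    have : s = 1 := tendsto_nhds_unique h1 hent
    simpa [this] using hcrit
  · rintro ⟨hl, h⟩
    exact ⟨hl, hasEntropy_one hl h⟩

end FigureEight

/-! ### The curve, its tangent line and the asymptotics of its speed -/

namespace FigureEight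

/-- The exponential of minus the second coordinate of the curve. -/
def curveExp (x : ℝ) : ℝ := (1 - Real.exp (-x)) / (1 + 3 * Real.exp (-x))

theorem exp_neg_lt_one_of_pos {x : ℝ} (hx : 0 < x) : Real.exp (-x) < 1 :=
  Real.exp_lt_one_iff.2 (by linarith)

theorem curveExp_pos {x : ℝ} (hx : 0 < x) : 0 < curveExp x :=
  div_pos (by linarith [exp_neg_lt_one_of_pos hx]) (by positivity)

theorem one_sub_curveExp (x : ℝ) :
    1 - curveExp x = 4 * Real.exp (-x) / (1 + 3 * Real.exp (-x)) := by
  unfold curveExp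
  have := Real.exp_pos (-x)
  field_simp
  ring

theorem curveExp_lt_one (x : ℝ) : curveExp x < 1 := by
  have h := one_sub_curveExp x
  have : 0 < 4 * Real.exp (-x) / (1 + 3 * Real.exp (-x)) := by positivity
  linarith

theorem curve_zero (x : ℝ) : figureEightCurve x 0 = x := rfl

theorem curve_one (x : ℝ) : figureEightCurve x 1 = -Real.log (curveExp x) := rfl

theorem exp_neg_curve_one {x : ℝ} (hx : 0 < x) :
    Real.exp (-figureEightCurve x 1) = curveExp x := by
  rw [curve_one, neg_neg, Real.exp_log (curveExp_pos hx)]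

theorem curve_pos {x : ℝ} (hx : 0 < x) (i : Fin 2) : 0 < figureEightCurve x i := by
  have : 0 < figureEightCurve x 1 := by
    rw [curve_one]
    linarith [Real.log_neg (curveExp_pos hx) (curveExp_lt_one x)]
  fin_cases i
  exacts [hx, this]

theorem critical_curve {x : ℝ} (hx : 0 < x) : Critical (figureEightCurve x) := by
  unfold Critical
  rw [exp_neg_curve_one hx, curve_zero, curveExp]
  have := Real.exp_pos (-x)
  field_simp
  ring

theorem eq_curve {l : Fin 2 → ℝ} (h : Critical l) : l = figureEightCurve (l 0) := by
  have h0 := Real.exp_pos (-l 0)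
  have h1 : Real.exp (-l 1) = curveExp (l 0) := by
    unfold Critical at h
    rw [curveExp, eq_div_iff (by positivity)]
    linarith
  funext i
  fin_cases i
  · rfl
  · show l 1 = figureEightCurve (l 0) 1
    rw [curve_one, ← h1, Real.log_exp, neg_neg]

theorem entropyOne_eq : figureEight.entropyOne = figureEightCurve '' Ioi 0 := by
  ext l
  rw [mem_entropyOne_iff]
  constructor
  · rintro ⟨hl, h⟩
    exact ⟨l 0, hl 0, (eq_curve h).symm⟩
  · rintro ⟨x, hx, rfl⟩
    exact ⟨curve_pos hx, critical_curve hx⟩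

/-- The curveSlope of the curve. -/
def curveSlope (x : ℝ) : ℝ := -((1 - curveExp x) / (1 - Real.exp (-x)))

theorem hasDerivAt_curve {x : ℝ} (hx : 0 < x) :
    HasDerivAt figureEightCurve ![1, curveSlope x] x := by
  have hX := exp_neg_lt_one_of_pos hx
  have hX0 := Real.exp_pos (-x)
  have hY := curveExp_pos hx
  rw [hasDerivAt_pi]
  intro i
  fin_cases i
  · exact hasDerivAt_id x
  · show HasDerivAt (fun x => -Real.log (curveExp x)) (curveSlope x) x
    have he : HasDerivAt (fun x : ℝ => Real.exp (-x)) (-Real.exp (-x)) x := by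
      simpa using (hasDerivAt_neg x).exp
    have h1 : HasDerivAt curveExp _ x :=
      (he.const_sub 1).div ((he.const_mul 3).const_add 1) (by positivity)
    refine (h1.log hY.ne').neg.congr_deriv ?_
    rw [curveSlope, one_sub_curveExp]
    unfold curveExp
    have : 1 - Real.exp (-x) ≠ 0 := by linarith
    field_simp
    ring

theorem deriv_curve {x : ℝ} (hx : 0 < x) : deriv figureEightCurve x = ![1, curveSlope x] :=
  (hasDerivAt_curve hx).deriv

/-- Vanishing mean is the single linear equation (1 - Y) φ 0 + (1 - X) φ 1 = 0, and `curveSlope` is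
the slope of its solution line. -/
theorem tangentSpace_curve {x : ℝ} (hx : 0 < x) :
    figureEight.tangentSpace (figureEightCurve x) =
      range (fun a : ℝ => a • deriv figureEightCurve x) := by
  have hX := exp_neg_lt_one_of_pos hx
  have hY := curveExp_lt_one x
  have hX' : 1 - Real.exp (-x) ≠ 0 := by linarith
  ext φ
  rw [deriv_curve hx]
  have h1 : φ ∈ figureEight.tangentSpace (figureEightCurve x) ↔
      (1 - curveExp x) * φ 0 + (1 - Real.exp (-x)) * φ 1 = 0 := by
    show ∫ y, figureEight.onShift φ y ∂(figureEight.eqState (figureEightCurve x)) = 0 ↔ _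
    rw [eqState_eq (curve_pos hx) (critical_curve hx),
      integral_onShift (curve_pos hx) (critical_curve hx), mean, exp_neg_curve_one hx, curve_zero,
      div_eq_zero_iff, or_iff_left (by linarith)]
  rw [h1]
  constructor
  · intro h
    refine ⟨φ 0, ?_⟩
    funext i
    fin_cases i
    · simp
    · simp only [curveSlope, Fin.mk_one, Pi.smul_apply, Matrix.cons_val_one, smul_eq_mul,
        Matrix.cons_val_fin_one]
      field_simp
      linarith
  · rintro ⟨a, rfl⟩
    simp only [curveSlope, Pi.smul_apply, Matrix.cons_val_one, smul_eq_mul, Matrix.cons_val_zero,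
      Matrix.cons_val_fin_one]
    field_simp
    ring

/-- The square of the speed of the curve. -/
def speedSq (x : ℝ) : ℝ :=
  (1 - curveExp x) * (Real.exp (-x) + curveExp x) / ((1 - Real.exp (-x)) *
    ((1 - curveExp x) * x + (1 - Real.exp (-x)) * -Real.log (curveExp x)))

theorem speedSq_denom_pos {x : ℝ} (hx : 0 < x) : 0 < (1 - Real.exp (-x)) *
    ((1 - curveExp x) * x + (1 - Real.exp (-x)) * -Real.log (curveExp x)) := by
  have hX := exp_neg_lt_one_of_pos hx
  have hY := curveExp_lt_one x
  have hy : 0 < -Real.log (curveExp x) := curve_pos hx 1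
  exact mul_pos (by linarith) (add_pos (mul_pos (by linarith) hx) (mul_pos (by linarith) hy))

theorem speedSq_pos {x : ℝ} (hx : 0 < x) : 0 < speedSq x := by
  have hY := curveExp_lt_one x
  have hY0 := curveExp_pos hx
  exact div_pos (mul_pos (by linarith) (by positivity)) (speedSq_denom_pos hx)

/-- The two components of the vector differ by a(2 - X - Y)/(1 - X), which cancels the powers of 2 -
X - Y in `variance` and `mean`. -/
theorem wpNormSq_smul_velocity {x : ℝ} (hx : 0 < x) (a : ℝ) :
    figureEight.wpNormSq (figureEightCurve x) (a • ![1, curveSlope x]) = a ^ 2 * speedSq x := by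
  have hX := exp_neg_lt_one_of_pos hx
  have hY := curveExp_lt_one x
  have hd := speedSq_denom_pos hx
  rw [wpNormSq_eq (curve_pos hx) (critical_curve hx), variance, mean, exp_neg_curve_one hx,
    curve_zero, curve_one, speedSq]
  simp only [curveSlope, Pi.smul_apply, Matrix.cons_val_one, smul_eq_mul, Matrix.cons_val_zero,
      Matrix.cons_val_fin_one]
  set X := Real.exp (-x)
  set Y := curveExp x
  set y := -Real.log Y
  have h1 : 1 - X ≠ 0 := by linarith
  have h2 : 2 - X - Y ≠ 0 := by linarith
  have h3 : (1 - Y) * x + (1 - X) * y ≠ 0 := (pos_of_mul_pos_right hd (by linarith)).ne'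
  field_simp
  ring

theorem wpNormSq_deriv_curve {x : ℝ} (hx : 0 < x) :
    figureEight.wpNormSq (figureEightCurve x) (deriv figureEightCurve x) = speedSq x := by
  have := wpNormSq_smul_velocity hx 1
  rwa [one_smul, one_pow, one_mul, ← deriv_curve hx] at this

theorem continuous_curveExp : Continuous curveExp := by
  unfold curveExp
  exact (by fun_prop : Continuous fun x : ℝ => 1 - Real.exp (-x)).div (by fun_prop)
    fun x => by positivity

theorem continuousOn_speedSq : ContinuousOn speedSq (Ioi 0) := by
  have h1 : Continuous fun x : ℝ => Real.exp (-x) := by fun_prop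
  have h2 := continuous_curveExp
  have h3 : ContinuousOn (fun x => -Real.log (curveExp x)) (Ioi 0) :=
    (h2.continuousOn.log fun x hx => (curveExp_pos hx).ne').neg
  refine ContinuousOn.div ?_ ?_ fun x hx => (speedSq_denom_pos hx).ne'
  · exact ((continuous_const.sub h2).mul (h1.add h2)).continuousOn
  · exact (continuous_const.sub h1).continuousOn.mul
      (((continuous_const.sub h2).mul continuous_id).continuousOn.add
        ((continuous_const.sub h1).continuousOn.mul h3))

theorem comparable_of_tendsto {F : Filter ℝ} {f g : ℝ → ℝ} {a : ℝ} (ha : 0 < a)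
    (h : Tendsto (fun x => f x / g x) F (𝓝 a)) : Comparable F f g := by
  refine ⟨a / 2, 2 * a, by positivity, by positivity, ?_⟩
  exact h.eventually (Ioo_mem_nhds (by linarith) (by linarith))

/-- As x → 0, 1 - X is asymptotic to x, Y tends to 0, and -log Y is asymptotic to -log x. The
denominator therefore behaves like x²(-log x), the numerator tends to 1. -/
theorem tendsto_speedSq_zero :
    Tendsto (fun x => speedSq x / (-1 / (x ^ 2 * Real.log x))) (𝓝[>] 0) (𝓝 1) := by
  have hX : Tendsto (fun x : ℝ => Real.exp (-x)) (𝓝[>] 0) (𝓝 1) := by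
    have : Continuous fun x : ℝ => Real.exp (-x) := by fun_prop
    simpa using (this.tendsto 0).mono_left nhdsWithin_le_nhds
  have hY : Tendsto curveExp (𝓝[>] 0) (𝓝 0) := by
    have := (continuous_curveExp.tendsto 0).mono_left (nhdsWithin_le_nhds (s := Ioi 0))
    simpa [curveExp] using this
  have hq : Tendsto (fun x : ℝ => (1 - Real.exp (-x)) / x) (𝓝[>] 0) (𝓝 1) := by
    have he : HasDerivAt (fun x : ℝ => 1 - Real.exp (-x)) 1 0 := by
      simpa using (hasDerivAt_neg (0 : ℝ)).exp.const_sub 1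
    have := he.tendsto_slope_zero_right
    simpa [div_eq_inv_mul] using this
  have hlog : Tendsto (fun x : ℝ => -Real.log x) (𝓝[>] 0) atTop :=
    tendsto_neg_atBot_atTop.comp Real.tendsto_log_nhdsGT_zero
  have hy : Tendsto (fun x : ℝ => -Real.log (curveExp x) / -Real.log x) (𝓝[>] 0) (𝓝 1) := by
    have h1 : Tendsto (fun x : ℝ => 1 + (-Real.log ((1 - Real.exp (-x)) / x) +
        Real.log (1 + 3 * Real.exp (-x))) / -Real.log x) (𝓝[>] 0) (𝓝 (1 + 0)) := by
      exact tendsto_const_nhds.add (((hq.log one_ne_zero).neg.add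
        (((hX.const_mul 3).const_add 1).log (by norm_num))).div_atTop hlog)
    rw [add_zero] at h1
    refine h1.congr' ?_
    filter_upwards [Ioo_mem_nhdsGT (one_pos : (0 : ℝ) < 1)] with x hx
    have hx0 : 0 < x := hx.1
    have hl : Real.log x < 0 := Real.log_neg hx.1 hx.2
    have hX1 := exp_neg_lt_one_of_pos hx0
    have hl' := hl.ne
    have hX2 : 1 - Real.exp (-x) ≠ 0 := by linarith
    rw [curveExp, Real.log_div hX2 hx0.ne', Real.log_div hX2 (by positivity)]
    field_simp
    ring
  have hmain : Tendsto (fun x : ℝ => (1 - curveExp x) * (Real.exp (-x) + curveExp x) /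
      (((1 - Real.exp (-x)) / x) * ((1 - curveExp x) / -Real.log x +
        ((1 - Real.exp (-x)) / x) * (-Real.log (curveExp x) / -Real.log x)))) (𝓝[>] 0)
      (𝓝 ((1 - 0) * (1 + 0) / (1 * (0 + 1 * 1)))) :=
    Tendsto.div ((hY.const_sub 1).mul (hX.add hY))
      (hq.mul (((hY.const_sub 1).div_atTop hlog).add (hq.mul hy))) (by norm_num)
  rw [show ((1 - 0) * (1 + 0) / (1 * (0 + 1 * 1))) = (1 : ℝ) by norm_num] at hmain
  refine hmain.congr' ?_
  filter_upwards [Ioo_mem_nhdsGT (one_pos : (0 : ℝ) < 1)] with x hx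
  have hx0 : 0 < x := hx.1
  have hl : Real.log x < 0 := Real.log_neg hx.1 hx.2
  have hd := speedSq_denom_pos hx0
  have hX1 := exp_neg_lt_one_of_pos hx0
  have h1 : 1 - Real.exp (-x) ≠ 0 := by linarith
  have h3 : (1 - curveExp x) * x + (1 - Real.exp (-x)) * -Real.log (curveExp x) ≠ 0 :=
    (pos_of_mul_pos_right hd (by linarith)).ne'
  have hl' := hl.ne
  rw [speedSq]
  set X := Real.exp (-x)
  set Y := curveExp x
  set y := -Real.log Y
  have hden : (1 - X) / x * ((1 - Y) / -Real.log x + (1 - X) / x * (y / -Real.log x)) =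
      (1 - X) * ((1 - Y) * x + (1 - X) * y) * (-1 / (x ^ 2 * Real.log x)) := by
    field_simp
    ring
  rw [hden, div_div]

/-- Divide by 1 - Y: the quotient -log Y/(1 - Y) is at most 1/Y, hence bounded for large x, so x
dominates the denominator. -/
theorem tendsto_speedSq_atTop :
    Tendsto (fun x => speedSq x / (1 / x)) atTop (𝓝 1) := by
  have hX : Tendsto (fun x : ℝ => Real.exp (-x)) atTop (𝓝 0) :=
    Real.tendsto_exp_neg_atTop_nhds_zero
  have hY : Tendsto curveExp atTop (𝓝 1) := by
    have : Tendsto curveExp atTop (𝓝 ((1 - 0) / (1 + 3 * 0))) :=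
      (hX.const_sub 1).div ((hX.const_mul 3).const_add 1) (by norm_num)
    simpa using this
  have hy : Tendsto (fun x => (-Real.log (curveExp x) / (1 - curveExp x)) / x) atTop (𝓝 0) := by
    have h1 : Tendsto (fun x => (curveExp x)⁻¹ / x) atTop (𝓝 0) :=
      (hY.inv₀ one_ne_zero).div_atTop tendsto_id
    refine squeeze_zero' ?_ ?_ h1
    · filter_upwards [eventually_gt_atTop 0] with x hx
      have h2 : 0 < -Real.log (curveExp x) := curve_pos hx 1
      have h3 := curveExp_lt_one x
      have h4 : 0 < 1 - curveExp x := by linarith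
      positivity
    · filter_upwards [eventually_gt_atTop 0] with x hx
      have h2 := curveExp_pos hx
      have h4 : 0 < 1 - curveExp x := by linarith [curveExp_lt_one x]
      refine div_le_div_of_nonneg_right ?_ hx.le
      rw [div_le_iff₀ h4]
      have := Real.one_sub_inv_le_log_of_pos h2
      have h5 : (curveExp x)⁻¹ * (1 - curveExp x) = (curveExp x)⁻¹ - 1 := by
        field_simp
      linarith
  have hmain : Tendsto (fun x : ℝ => (Real.exp (-x) + curveExp x) / ((1 - Real.exp (-x)) *
      (1 + (1 - Real.exp (-x)) * ((-Real.log (curveExp x) / (1 - curveExp x)) / x)))) atTop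
      (𝓝 ((0 + 1) / ((1 - 0) * (1 + (1 - 0) * 0)))) :=
    Tendsto.div (hX.add hY) ((hX.const_sub 1).mul ((((hX.const_sub 1).mul hy).const_add 1)))
      (by norm_num)
  rw [show ((0 + 1) / ((1 - 0) * (1 + (1 - 0) * 0))) = (1 : ℝ) by norm_num] at hmain
  refine hmain.congr' ?_
  filter_upwards [eventually_gt_atTop 0] with x hx
  have hd := speedSq_denom_pos hx
  have hX1 := exp_neg_lt_one_of_pos hx
  have hY1 : 1 - curveExp x ≠ 0 := by linarith [curveExp_lt_one x]
  have h1 : 1 - Real.exp (-x) ≠ 0 := by linarith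
  have h3 : (1 - curveExp x) * x + (1 - Real.exp (-x)) * -Real.log (curveExp x) ≠ 0 :=
    (pos_of_mul_pos_right hd (by linarith)).ne'
  rw [speedSq]
  set X := Real.exp (-x)
  set Y := curveExp x
  set y := -Real.log Y
  have hden : (1 - X) * (1 + (1 - X) * (y / (1 - Y) / x)) =
      (1 - X) * ((1 - Y) * x + (1 - X) * y) / ((1 - Y) * x) := by
    field_simp
  rw [hden]
  field_simp

theorem comparable_zero : Comparable (𝓝[>] 0)
    (fun x => figureEight.wpNormSq (figureEightCurve x) (deriv figureEightCurve x))
    (fun x => -1 / (x ^ 2 * Real.log x)) := by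
  refine comparable_of_tendsto one_pos (tendsto_speedSq_zero.congr' ?_)
  filter_upwards [self_mem_nhdsWithin] with x hx
  rw [wpNormSq_deriv_curve hx]

theorem comparable_atTop : Comparable atTop
    (fun x => figureEight.wpNormSq (figureEightCurve x) (deriv figureEightCurve x))
    (fun x => 1 / x) := by
  refine comparable_of_tendsto one_pos (tendsto_speedSq_atTop.congr' ?_)
  filter_upwards [eventually_gt_atTop 0] with x hx
  rw [wpNormSq_deriv_curve hx]

end FigureEight

/-! ### Arc length, path distance and completeness -/

namespace FigureEight

/-- The speed of the curve. -/
def speed (x : ℝ) : ℝ := √(speedSq x)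

theorem speed_pos {x : ℝ} (hx : 0 < x) : 0 < speed x := Real.sqrt_pos.2 (speedSq_pos hx)

theorem continuousOn_speed : ContinuousOn speed (Ioi 0) := continuousOn_speedSq.sqrt

/-- The arc length parameter of the curve. -/
def arc (x : ℝ) : ℝ := ∫ t in (1 : ℝ)..x, speed t

theorem hasDerivAt_arc {x : ℝ} (hx : 0 < x) : HasDerivAt arc (speed x) x := by
  have hsub : uIcc 1 x ⊆ Ioi 0 := fun t ht => lt_of_lt_of_le (lt_min one_pos hx) ht.1
  refine intervalIntegral.integral_hasDerivAt_right
    (continuousOn_speed.mono hsub).intervalIntegrable ?_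
    (continuousOn_speed.continuousAt (Ioi_mem_nhds hx))
  exact continuousOn_speed.stronglyMeasurableAtFilter isOpen_Ioi x hx

theorem strictMonoOn_arc : StrictMonoOn arc (Ioi 0) := by
  refine strictMonoOn_of_deriv_pos (convex_Ioi 0)
    (fun x hx => (hasDerivAt_arc hx).continuousAt.continuousWithinAt) fun x hx => ?_
  rw [interior_Ioi] at hx
  rw [(hasDerivAt_arc hx).deriv]
  exact speed_pos hx

/-- Since x times the squared speed eventually exceeds 1/4, the speed is at least 1/(2√x), the
derivative of √x. So `arc` minus the square root is eventually monotone. -/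
theorem tendsto_arc_atTop : Tendsto arc atTop atTop := by
  obtain ⟨N, hN⟩ := eventually_atTop.1 (tendsto_speedSq_atTop.eventually
    (lt_mem_nhds (by norm_num : (1 / 4 : ℝ) < 1)))
  set A := max N 1 with hA
  have hspeed {x : ℝ} (hx : A < x) : 1 / 2 * (1 / √x) ≤ speed x := by
    have hx0 : 0 < x := lt_of_lt_of_le one_pos ((le_max_right N 1).trans hx.le)
    have h := hN x ((le_max_left N 1).trans hx.le)
    rw [lt_div_iff₀ (by positivity)] at h
    refine Real.le_sqrt_of_sq_le ?_
    rw [mul_pow, div_pow, div_pow, Real.sq_sqrt hx0.le]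
    norm_num at h ⊢
    exact h.le
  have hmono : MonotoneOn (fun x => arc x - √x) (Ici A) := by
    have hder (x : ℝ) (hx : 0 < x) :
        HasDerivAt (fun x => arc x - √x) (speed x - 1 / (2 * √x)) x :=
      (hasDerivAt_arc hx).sub (Real.hasDerivAt_sqrt hx.ne')
    have hpos {x : ℝ} (hx : A ≤ x) : 0 < x :=
      lt_of_lt_of_le one_pos ((le_max_right N 1).trans hx)
    refine monotoneOn_of_deriv_nonneg (convex_Ici A)
      (fun x hx => (hder x (hpos hx)).continuousAt.continuousWithinAt) ?_ ?_
    · intro x hx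
      rw [interior_Ici] at hx
      exact (hder x (hpos hx.le)).differentiableAt.differentiableWithinAt
    · intro x hx
      rw [interior_Ici] at hx
      rw [(hder x (hpos hx.le)).deriv, sub_nonneg]
      refine le_trans (le_of_eq ?_) (hspeed hx)
      rw [one_div, one_div, one_div, mul_inv]
  refine tendsto_atTop_mono' _ ?_
    (tendsto_atTop_add_const_left atTop (arc A - √A) Real.tendsto_sqrt_atTop)
  filter_upwards [eventually_ge_atTop A] with x hx
  have := hmono self_mem_Ici hx hx
  simp only at this
  linarith

/-- Near 0 the speed is at least 1/(2x√(-log x)), the derivative of -√(-log x), so `arc` lies below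
a constant minus √(-log x). -/
theorem tendsto_arc_zero : Tendsto arc (𝓝[>] 0) atBot := by
  have hev := (tendsto_speedSq_zero.eventually
    (lt_mem_nhds (by norm_num : (1 / 4 : ℝ) < 1))).and (Ioo_mem_nhdsGT (one_pos : (0 : ℝ) < 1))
  obtain ⟨δ, hδ, hsub⟩ := mem_nhdsGT_iff_exists_Ioo_subset.1 hev
  have hδ0 : 0 < δ := hδ
  have hlog {x : ℝ} (hx : x ∈ Ioo 0 δ) : 0 < -Real.log x := by
    have := (hsub hx).2
    linarith [Real.log_neg this.1 this.2]
  have hspeed {x : ℝ} (hx : x ∈ Ioo 0 δ) : 1 / (2 * √(-Real.log x)) * x⁻¹ ≤ speed x := by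
    have h := (hsub hx).1
    have hl := hlog hx
    have hx0 : 0 < x := hx.1
    have heq : -1 / (x ^ 2 * Real.log x) = 1 / (x ^ 2 * -Real.log x) := by
      rw [mul_neg, div_neg, neg_div]
    rw [heq, lt_div_iff₀ (by positivity)] at h
    refine Real.le_sqrt_of_sq_le (le_trans (le_of_eq ?_) h.le)
    rw [mul_pow, div_pow, mul_pow, Real.sq_sqrt hl.le]
    field_simp
    norm_num
  have hder {x : ℝ} (hx : x ∈ Ioo 0 δ) : HasDerivAt (fun x => arc x + √(-Real.log x))
      (speed x - 1 / (2 * √(-Real.log x)) * x⁻¹) x := by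
    have h1 : HasDerivAt (fun x => √(-Real.log x)) (-(x⁻¹) / (2 * √(-Real.log x))) x :=
      (Real.hasDerivAt_log hx.1.ne').neg.sqrt (hlog hx).ne'
    refine ((hasDerivAt_arc hx.1).add h1).congr_deriv ?_
    ring
  have hmono : MonotoneOn (fun x => arc x + √(-Real.log x)) (Ioo 0 δ) := by
    refine monotoneOn_of_deriv_nonneg (convex_Ioo 0 δ)
      (fun x hx => (hder hx).continuousAt.continuousWithinAt) ?_ ?_
    · intro x hx
      rw [interior_Ioo] at hx
      exact (hder hx).differentiableAt.differentiableWithinAt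
    · intro x hx
      rw [interior_Ioo] at hx
      rw [(hder hx).deriv, sub_nonneg]
      exact hspeed hx
  have hlim : Tendsto (fun x => -√(-Real.log x)) (𝓝[>] 0) atBot :=
    tendsto_neg_atTop_atBot.comp (Real.tendsto_sqrt_atTop.comp
      (tendsto_neg_atBot_atTop.comp Real.tendsto_log_nhdsGT_zero))
  refine tendsto_atBot_mono' _ ?_ (tendsto_atBot_add_const_left (𝓝[>] 0)
    (arc (δ / 2) + √(-Real.log (δ / 2))) hlim)
  filter_upwards [Ioo_mem_nhdsGT (half_pos hδ0)] with x hx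
  have hx' : x ∈ Ioo 0 δ := ⟨hx.1, by linarith [hx.2]⟩
  have := hmono hx' ⟨half_pos hδ0, half_lt_self hδ0⟩ hx.2.le
  simp only at this
  linarith

theorem surjOn_arc : SurjOn arc (Ioi 0) univ := by
  intro y _
  obtain ⟨a, ha, ha0⟩ := ((tendsto_arc_zero.eventually (eventually_le_atBot y)).and
    self_mem_nhdsWithin).exists
  obtain ⟨b, hb, hab⟩ := ((tendsto_arc_atTop.eventually (eventually_ge_atTop y)).and
    (eventually_ge_atTop a)).exists
  have ha0' : 0 < a := ha0
  obtain ⟨x, hx, hxy⟩ := intermediate_value_Icc hab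
    (fun x hx => (hasDerivAt_arc (ha0'.trans_le hx.1)).continuousAt.continuousWithinAt) ⟨ha, hb⟩
  exact ⟨x, ha0'.trans_le hx.1, hxy⟩

theorem wpNorm_smul_velocity {x : ℝ} (hx : 0 < x) (a : ℝ) :
    figureEight.wpNorm (figureEightCurve x) (a • ![1, curveSlope x]) = |a| * speed x := by
  rw [FinGraph.wpNorm, wpNormSq_smul_velocity hx, Real.sqrt_mul (sq_nonneg a), Real.sqrt_sq_eq_abs,
    speed]

theorem contDiffOn_curve : ContDiffOn ℝ 1 figureEightCurve (Ioi 0) := by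
  rw [contDiffOn_pi]
  intro i
  have he : ContDiff ℝ 1 fun x : ℝ => Real.exp (-x) := Real.contDiff_exp.comp contDiff_neg
  fin_cases i
  · exact contDiffOn_id
  · show ContDiffOn ℝ 1 (fun x => -Real.log (curveExp x)) (Ioi 0)
    refine (ContDiffOn.log ?_ fun x hx => (curveExp_pos hx).ne').neg
    exact ((contDiff_const.sub he).div (contDiff_const.add (contDiff_const.mul he))
      fun x => by positivity).contDiffOn

section Length

variable {γ : ℝ → Fin 2 → ℝ} {l₁ l₂ : Fin 2 → ℝ}

theorem curve_coord_pos (hγ : figureEight.IsCurve l₁ l₂ γ)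
    {t : ℝ} (ht : t ∈ Icc (0 : ℝ) 1) : 0 < γ t 0 :=
  (hγ.2.1 t ht).1 0

theorem eq_curve_coord (hγ : figureEight.IsCurve l₁ l₂ γ)
    {t : ℝ} (ht : t ∈ Icc (0 : ℝ) 1) : γ t = figureEightCurve (γ t 0) :=
  eq_curve (mem_entropyOne_iff.1 (hγ.2.1 t ht)).2

theorem contDiffOn_coord (hγ : figureEight.IsCurve l₁ l₂ γ)
    : ContDiffOn ℝ 1 (fun t => γ t 0) (Icc 0 1) :=
  contDiffOn_pi.1 hγ.1 0

theorem continuousOn_derivWithin_coord (hγ : figureEight.IsCurve l₁ l₂ γ) :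
    ContinuousOn (derivWithin (fun t => γ t 0) (Icc 0 1)) (Icc 0 1) :=
  (contDiffOn_coord hγ).continuousOn_derivWithin (uniqueDiffOn_Icc one_pos) le_rfl

theorem hasDerivWithinAt_coord (hγ : figureEight.IsCurve l₁ l₂ γ) {t : ℝ} (ht : t ∈ Icc (0 : ℝ) 1) :
    HasDerivWithinAt (fun t => γ t 0) (derivWithin (fun t => γ t 0) (Icc 0 1) t) (Icc 0 1) t :=
  ((contDiffOn_coord hγ).differentiableOn one_ne_zero t ht).hasDerivWithinAt

/-- A curve in the moduli space is determined by its first coordinate, so by the chain rule its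
velocity is a multiple of the velocity of `figureEightCurve`. -/
theorem wpNorm_derivWithin (hγ : figureEight.IsCurve l₁ l₂ γ) {t : ℝ} (ht : t ∈ Icc (0 : ℝ) 1) :
    figureEight.wpNorm (γ t) (derivWithin γ (Icc 0 1) t) =
      |derivWithin (fun t => γ t 0) (Icc 0 1) t| * speed (γ t 0) := by
  have hpos := curve_coord_pos hγ ht
  have h1 := (hasDerivAt_curve hpos).scomp_hasDerivWithinAt t (hasDerivWithinAt_coord hγ ht)
  have h2 := (h1.congr (fun s hs => eq_curve_coord hγ hs) (eq_curve_coord hγ ht)).derivWithin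
    (uniqueDiffOn_Icc one_pos t ht)
  rw [h2, ← wpNorm_smul_velocity hpos, ← eq_curve_coord hγ ht]

theorem continuousOn_velocity (hγ : figureEight.IsCurve l₁ l₂ γ) : ContinuousOn
    (fun t => derivWithin (fun t => γ t 0) (Icc 0 1) t * speed (γ t 0)) (Icc 0 1) :=
  (continuousOn_derivWithin_coord hγ).mul (continuousOn_speed.comp
    (contDiffOn_coord hγ).continuousOn fun _ ht => curve_coord_pos hγ ht)

theorem wpLength_eq (hγ : figureEight.IsCurve l₁ l₂ γ)
    : figureEight.wpLength γ = ENNReal.ofReal (∫ t in (0 : ℝ)..1,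
    |derivWithin (fun t => γ t 0) (Icc 0 1) t * speed (γ t 0)|) := by
  rw [intervalIntegral.integral_of_le zero_le_one, ← integral_Icc_eq_integral_Ioc,
    ofReal_integral_eq_lintegral_ofReal]
  · refine setLIntegral_congr_fun measurableSet_Icc fun t ht => ?_
    rw [wpNorm_derivWithin hγ ht, abs_mul, abs_of_pos (speed_pos (curve_coord_pos hγ ht))]
  · exact (continuousOn_velocity hγ).abs.integrableOn_Icc
  · exact ae_of_all _ fun t => abs_nonneg _

theorem integral_velocity (hγ : figureEight.IsCurve l₁ l₂ γ) : ∫ t in (0 : ℝ)..1,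
    derivWithin (fun t => γ t 0) (Icc 0 1) t * speed (γ t 0) = arc (l₂ 0) - arc (l₁ 0) := by
  have hder {t : ℝ} (ht : t ∈ Icc (0 : ℝ) 1) : HasDerivWithinAt (fun t => arc (γ t 0))
      (derivWithin (fun t => γ t 0) (Icc 0 1) t * speed (γ t 0)) (Icc 0 1) t := by
    rw [mul_comm]
    exact (hasDerivAt_arc (curve_coord_pos hγ ht)).comp_hasDerivWithinAt t
      (hasDerivWithinAt_coord hγ ht)
  rw [intervalIntegral.integral_eq_sub_of_hasDerivAt_of_le zero_le_one
    (f := fun t => arc (γ t 0)) (fun t ht => (hder ht).continuousWithinAt)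
    (fun t ht => (hder (Ioo_subset_Icc_self ht)).hasDerivAt (Icc_mem_nhds ht.1 ht.2)),
    hγ.2.2.1, hγ.2.2.2]
  refine ContinuousOn.intervalIntegrable ?_
  rw [uIcc_of_le zero_le_one]
  exact continuousOn_velocity hγ

/-- The signed velocity integrates to the difference of arc lengths; the length integrates its
absolute value. -/
theorem le_wpLength (hγ : figureEight.IsCurve l₁ l₂ γ)
    : ENNReal.ofReal |arc (l₂ 0) - arc (l₁ 0)| ≤ figureEight.wpLength γ := by
  rw [wpLength_eq hγ, ← integral_velocity hγ]
  exact ENNReal.ofReal_le_ofReal (intervalIntegral.abs_integral_le_integral_abs zero_le_one)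

end Length

/-- Moving the first coordinate linearly from `a` to `b` gives a signed velocity of constant sign,
so the lower bound for the length is attained. -/
theorem exists_curve_wpLength_eq {a b : ℝ} (ha : 0 < a) (hb : 0 < b) :
    ∃ γ, figureEight.IsCurve (figureEightCurve a) (figureEightCurve b) γ ∧
      figureEight.wpLength γ = ENNReal.ofReal |arc b - arc a| := by
  have hpos {t : ℝ} (ht : t ∈ Icc (0 : ℝ) 1) : 0 < a + t * (b - a) := by
    have h1 : a + t * (b - a) = (1 - t) * a + t * b := by ring
    rw [h1]
    rcases ht.1.eq_or_lt with h0 | h0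
    · simpa [← h0] using ha
    · have h2 : 0 ≤ (1 - t) * a := mul_nonneg (by linarith [ht.2]) ha.le
      have h3 : 0 < t * b := mul_pos h0 hb
      linarith
  have hγ : figureEight.IsCurve (figureEightCurve a) (figureEightCurve b)
      (fun t => figureEightCurve (a + t * (b - a))) := by
    refine ⟨?_, fun t ht => ?_, by simp, by simp⟩
    · exact contDiffOn_curve.comp (by fun_prop) fun t ht => hpos ht
    · rw [entropyOne_eq]
      exact ⟨_, hpos ht, rfl⟩
  refine ⟨_, hγ, ?_⟩
  rw [wpLength_eq hγ]
  have hint := integral_velocity hγ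
  simp only [curve_zero] at hint ⊢
  have hd {t : ℝ} (ht : t ∈ Icc (0 : ℝ) 1) :
      derivWithin (fun t => a + t * (b - a)) (Icc 0 1) t = b - a := by
    have : HasDerivAt (fun t => a + t * (b - a)) (b - a) t := by
      simpa using ((hasDerivAt_id t).mul_const (b - a)).const_add a
    exact this.hasDerivWithinAt.derivWithin (uniqueDiffOn_Icc one_pos t ht)
  have h01 : uIcc (0 : ℝ) 1 = Icc 0 1 := uIcc_of_le zero_le_one
  have hc1 : ∫ t in (0 : ℝ)..1, derivWithin (fun t => a + t * (b - a)) (Icc 0 1) t *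
      speed (a + t * (b - a)) = ∫ t in (0 : ℝ)..1, (b - a) * speed (a + t * (b - a)) :=
    intervalIntegral.integral_congr fun t ht => by simp only [hd (h01 ▸ ht)]
  have hc2 : ∫ t in (0 : ℝ)..1, |derivWithin (fun t => a + t * (b - a)) (Icc 0 1) t *
      speed (a + t * (b - a))| = ∫ t in (0 : ℝ)..1, |b - a| * speed (a + t * (b - a)) :=
    intervalIntegral.integral_congr fun t ht => by
      simp only [hd (h01 ▸ ht)]
      rw [abs_mul, abs_of_pos (speed_pos (hpos (h01 ▸ ht)))]
  rw [hc2, ← hint, hc1, intervalIntegral.integral_const_mul, intervalIntegral.integral_const_mul,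
    abs_mul]
  congr 2
  refine (abs_of_nonneg (intervalIntegral.integral_nonneg zero_le_one fun t ht => ?_)).symm
  exact (speed_pos (hpos ht)).le

/-- The path distance is the difference of the arc length parameters. -/
theorem wpDist_curve {a b : ℝ} (ha : 0 < a) (hb : 0 < b) :
    figureEight.wpDist (figureEightCurve a) (figureEightCurve b) =
      ENNReal.ofReal |arc b - arc a| := by
  apply le_antisymm
  · obtain ⟨γ, hγ, hlen⟩ := exists_curve_wpLength_eq ha hb
    exact (iInf₂_le γ hγ).trans hlen.le
  · exact le_iInf₂ fun γ hγ => le_wpLength hγ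

/-- Arc length is a bijection onto ℝ, and the metric induced by it has the path distance as its
`edist`. Completeness is carried over from ℝ. -/
theorem exists_metric : ∃ M : MetricSpace figureEight.EntropyOneSpace,
    (∀ l l' : figureEight.EntropyOneSpace, M.edist l l' = figureEight.wpDist l.1 l'.1) ∧
      @CompleteSpace figureEight.EntropyOneSpace M.toUniformSpace := by
  let F : figureEight.EntropyOneSpace → ℝ := fun l => arc (l.1 0)
  have hpos (l : figureEight.EntropyOneSpace) : 0 < l.1 0 := l.2.1 0
  have hcurve (l : figureEight.EntropyOneSpace) : l.1 = figureEightCurve (l.1 0) :=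
    eq_curve (mem_entropyOne_iff.1 l.2).2
  have hinj : Function.Injective F := fun l l' h => by
    apply Subtype.ext
    rw [hcurve l, hcurve l', strictMonoOn_arc.injOn (hpos l) (hpos l') h]
  have hsurj : Function.Surjective F := fun y => by
    obtain ⟨x, hx, rfl⟩ := surjOn_arc (mem_univ y)
    exact ⟨⟨figureEightCurve x, by rw [entropyOne_eq]; exact ⟨x, hx, rfl⟩⟩, rfl⟩
  refine ⟨MetricSpace.induced F hinj inferInstance, fun l l' => ?_, ?_⟩
  · rw [hcurve l, hcurve l', wpDist_curve (hpos l) (hpos l')]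
    show edist (F l) (F l') = _
    rw [edist_dist, dist_comm, Real.dist_eq]
  · let := MetricSpace.induced F hinj inferInstance
    have hiso : Isometry F := fun _ _ => rfl
    exact (hiso.isUniformInducing.completeSpace_congr hsurj).2 inferInstance

theorem tendsto_wpDist {x₀ : ℝ} (hx₀ : 0 < x₀) :
    Tendsto (fun x => figureEight.wpDist (figureEightCurve x₀) (figureEightCurve x))
      (𝓝[>] 0) (𝓝 ⊤) ∧
    Tendsto (fun x => figureEight.wpDist (figureEightCurve x₀) (figureEightCurve x))
      atTop (𝓝 ⊤) := by
  constructor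
  · have h : Tendsto (fun x => ENNReal.ofReal |arc x - arc x₀|) (𝓝[>] 0) (𝓝 ⊤) :=
      ENNReal.tendsto_ofReal_atTop.comp (tendsto_abs_atBot_atTop.comp
        (tendsto_atBot_add_const_right _ (-arc x₀) tendsto_arc_zero))
    refine h.congr' ?_
    filter_upwards [self_mem_nhdsWithin] with x hx
    exact (wpDist_curve hx₀ hx).symm
  · have h : Tendsto (fun x => ENNReal.ofReal |arc x - arc x₀|) atTop (𝓝 ⊤) :=
      ENNReal.tendsto_ofReal_atTop.comp (tendsto_abs_atTop_atTop.comp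
        (tendsto_atTop_add_const_right _ (-arc x₀) tendsto_arc_atTop))
    refine h.congr' ?_
    filter_upwards [eventually_gt_atTop 0] with x hx
    exact (wpDist_curve hx₀ hx).symm

end FigureEight

end

theorem proposition4p2 :
    -- the moduli space is the curve `c(x)`, `x > 0`
    figureEight.entropyOne = figureEightCurve '' Set.Ioi 0 ∧
    -- the objects defining the metric are well defined
    (∀ l ∈ figureEight.entropyOne,
      (∃! m : MeasureTheory.Measure figureEight.Shift,
        figureEight.IsEquilibriumState (fun x => -figureEight.onShift l x) m) ∧
      0 < ∫ x, figureEight.onShift l x ∂(figureEight.eqState l) ∧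
      ∀ φ ∈ figureEight.tangentSpace l,
        Filter.Tendsto
          (figureEight.varSeq (figureEight.onShift φ) (figureEight.eqState l)) Filter.atTop
          (nhds (figureEight.asympVar (figureEight.onShift φ) (figureEight.eqState l)))) ∧
    -- the tangent line at `c(x)` is spanned by the velocity of the curve
    (∀ x : ℝ, 0 < x → DifferentiableAt ℝ figureEightCurve x ∧
      figureEight.tangentSpace (figureEightCurve x) =
        Set.range (fun a : ℝ => a • deriv figureEightCurve x)) ∧
    -- the path distance is a metric, and it is complete
    (∃ M : MetricSpace figureEight.EntropyOneSpace,
      (∀ l l' : figureEight.EntropyOneSpace, M.edist l l' = figureEight.wpDist l.1 l'.1) ∧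
      @CompleteSpace figureEight.EntropyOneSpace M.toUniformSpace) ∧
    -- the asymptotics of the norm at the two ends
    Comparable (nhdsWithin 0 (Set.Ioi 0))
      (fun x => figureEight.wpNormSq (figureEightCurve x) (deriv figureEightCurve x))
      (fun x => -1 / (x ^ 2 * Real.log x)) ∧
    Comparable Filter.atTop
      (fun x => figureEight.wpNormSq (figureEightCurve x) (deriv figureEightCurve x))
      (fun x => 1 / x) ∧
    -- both ends lie at infinite distance
    (∀ x₀ : ℝ, 0 < x₀ →
      Filter.Tendsto
        (fun x => figureEight.wpDist (figureEightCurve x₀) (figureEightCurve x))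
        (nhdsWithin 0 (Set.Ioi 0)) (nhds ⊤) ∧
      Filter.Tendsto
        (fun x => figureEight.wpDist (figureEightCurve x₀) (figureEightCurve x))
        Filter.atTop (nhds ⊤)) := by
  refine ⟨FigureEight.entropyOne_eq, ?_, ?_, FigureEight.exists_metric,
    FigureEight.comparable_zero, FigureEight.comparable_atTop,
    fun x₀ hx₀ => FigureEight.tendsto_wpDist hx₀⟩
  · intro l hl
    obtain ⟨hpos, hcrit⟩ := FigureEight.mem_entropyOne_iff.1 hl
    refine ⟨⟨FigureEight.gibbs l, (FigureEight.isEquilibriumState_iff hpos hcrit _).2 rfl,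
      fun m hm => (FigureEight.isEquilibriumState_iff hpos hcrit m).1 hm⟩, ?_, fun φ _ => ?_⟩
    · rw [FigureEight.eqState_eq hpos hcrit, FigureEight.integral_onShift hpos hcrit]
      exact FigureEight.mean_self_pos hpos
    · rw [FigureEight.asympVar_eq hpos hcrit]
      exact FigureEight.tendsto_varSeq hpos hcrit φ
  · exact fun x hx => ⟨(FigureEight.hasDerivAt_curve hx).differentiableAt,
      FigureEight.tangentSpace_curve hx⟩
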